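/- Let $\Omega\subset\mathbb{R}^2$ be a bounded convex domain (nonempty, open; such a domain is Lipschitz), and let $\mathcal{T}_h$ be a finite conforming triangulation of $\overline\Omega$. Let $B^3_{h0}$ be the space of all $v\in L^2(\Omega)$ such that $v|_T$ is a polynomial of degree at most $3$ for every triangle $T\in\mathcal{T}_h$; $v$ is continuous at all vertices of the mesh and $v(a)=0$ at every vertex $a\in\partial\Omega$; and for every edge $e$ of the mesh $$\int_e [\![ v ]\!]\,ds=0,\qquad \int_e p\,[\![ \partial_n v ]\!]\,ds=0\quad\text{for all } p\in P_1(e),$$ where $[\![\cdot]\!]$ is the jump across $e$ if $e$ is an interior edge and the trace on $e$ if $e\subset\partial\Omega$, and $\partial_n$ is the derivative along a unit normal of $e$. For vector fields $\boldsymbol w=(w_1,w_2)$ and scalar functions $\varphi$ put $\operatorname{div}\boldsymbol w=\partial_1 w_1+\partial_2 w_2$, $\operatorname{rot}\boldsymbol w=\partial_1 w_2-\partial_2 w_1$, $\nabla\varphi=(\partial_1\varphi,\partial_2\varphi)$, $\operatorname{curl}\varphi=(\partial_2\varphi,-\partial_1\varphi)$; a subscript $h$ means that the operator is applied on each triangle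 separately. Then for all $\boldsymbol w_h,\boldsymbol v_h\in (B^3_{h0})^2$ $$(\nabla_h \operatorname{div}_h\boldsymbol w_h,\ \operatorname{curl}_h\operatorname{rot}_h\boldsymbol v_h)=\sum_{T\in\mathcal{T}_h}\int_T \nabla \operatorname{div}\boldsymbol w_h\cdot \operatorname{curl}\operatorname{rot}\boldsymbol v_h\,dx=0 .$$ -/

import Mathlib

open MeasureTheory

noncomputable section

/-- The Euclidean plane `ℝ²`. -/
abbrev Plane : Type := EuclideanSpace ℝ (Fin 2)

/-- A (conforming) triangular mesh of `Ω`: a finite geometric simplicial complex, all of whose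
simplices are faces of its triangles, and whose triangles cover `closure Ω` exactly. -/
structure TriMesh (Ω : Set Plane) extends Geometry.SimplicialComplex ℝ Plane where
  finite_faces : faces.Finite
  pure : ∀ s ∈ faces, ∃ t ∈ faces, s ⊆ t ∧ t.card = 3
  space_eq : toSimplicialComplex.space = closure Ω

namespace TriMesh

variable {Ω : Set Plane} (M : TriMesh Ω)

/-- The triangles of the mesh, each given by its set of three vertices. -/
def triangles : Finset (Finset Plane) :=
  M.finite_faces.toFinset.filter fun T => T.card = 3

/-- `a` and `b` are the two endpoints of an edge of the mesh. -/
def IsEdge (a b : Plane) : Prop :=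
  a ≠ b ∧ ∃ e ∈ M.faces, (e : Set Plane) = {a, b}

/-- The edge with endpoints `a`, `b` lies on the boundary of `Ω`. -/
def IsBoundaryEdge (a b : Plane) : Prop :=
  M.IsEdge a b ∧ segment ℝ a b ⊆ frontier Ω

/-- An interior edge: an edge which is not a boundary edge. -/
def IsInteriorEdge (a b : Plane) : Prop :=
  M.IsEdge a b ∧ ¬ segment ℝ a b ⊆ frontier Ω

end TriMesh

/-- The open triangle with vertex set `T`. -/
def openTri (T : Finset Plane) : Set Plane :=
  interior (convexHull ℝ (T : Set Plane))

/-- The polynomial function on the plane given by `q ∈ ℝ[x₁, x₂]`. -/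
def polyFun (q : MvPolynomial (Fin 2) ℝ) (x : Plane) : ℝ :=
  MvPolynomial.eval (fun i => x i) q

/-- `∂f/∂xᵢ`, pointwise. At a point of an open triangle of a mesh it only depends on the
restriction of `f` to that triangle, so applied to piecewise smooth functions it is the broken
(element by element) partial derivative; the edges of the mesh form a null set. -/
def brokenPartial (i : Fin 2) (f : Plane → ℝ) (x : Plane) : ℝ :=
  fderiv ℝ f x (EuclideanSpace.single i 1)

/-- Broken gradient `(∂₁ f, ∂₂ f)` of a scalar function. -/
def brokenGrad (f : Plane → ℝ) (x : Plane) : Plane :=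
  !₂[brokenPartial 0 f x, brokenPartial 1 f x]

/-- Broken (vector) curl `(∂₂ f, -∂₁ f)` of a scalar function. -/
def brokenCurl (f : Plane → ℝ) (x : Plane) : Plane :=
  !₂[brokenPartial 1 f x, -brokenPartial 0 f x]

/-- Broken divergence `∂₁ w₁ + ∂₂ w₂` of a vector field. -/
def brokenDiv (w : Fin 2 → Plane → ℝ) (x : Plane) : ℝ :=
  brokenPartial 0 (w 0) x + brokenPartial 1 (w 1) x

/-- Broken (scalar) rotation `∂₁ v₂ - ∂₂ v₁` of a vector field. -/
def brokenRot (v : Fin 2 → Plane → ℝ) (x : Plane) : ℝ :=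
  brokenPartial 0 (v 1) x - brokenPartial 1 (v 0) x

/-- The broken `L²` inner product `∑_T ∫_T F · G dx` of two vector fields. -/
def brokenInner {Ω : Set Plane} (M : TriMesh Ω) (F G : Plane → Plane) : ℝ :=
  ∑ T ∈ M.triangles, ∫ x in openTri T, inner ℝ (F x) (G x)

/-- The integral `∫_e f ds` with respect to arc length over the segment `e` from `a` to `b`. -/
def edgeIntegral (a b : Plane) (f : Plane → ℝ) : ℝ :=
  dist a b * ∫ t in (0 : ℝ)..1, f (AffineMap.lineMap a b t)

/-- A unit normal vector of the segment from `a` to `b`. -/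
def unitNormal (a b : Plane) : Plane :=
  ‖b - a‖⁻¹ • !₂[b 1 - a 1, -(b 0 - a 0)]

/-- The derivative of `f` in the direction of the unit normal of the segment from `a` to `b`. -/
def normalDeriv (a b : Plane) (f : Plane → ℝ) (x : Plane) : ℝ :=
  fderiv ℝ f x (unitNormal a b)

/-- `v ∈ L²(Ω)` is piecewise a polynomial of degree at most `k`: on each open triangle `T` it is
given by the polynomial `q T`. (These polynomials are unique; they give the one-sided traces of
`v` and of its derivatives on the edges, and the values of `v|_T` at the vertices.) -/
def HasPieces {Ω : Set Plane} (M : TriMesh Ω) (k : ℕ) (v : Plane → ℝ)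
    (q : Finset Plane → MvPolynomial (Fin 2) ℝ) : Prop :=
  MemLp v 2 (volume.restrict Ω) ∧
    ∀ T ∈ M.triangles, (q T).totalDegree ≤ k ∧ ∀ x ∈ openTri T, v x = polyFun (q T) x

/-- The conditions defining `B_h³` in terms of the polynomial pieces: continuity at the vertices,
and, across every interior edge `e`, jump of mean zero and jump of the normal derivative
orthogonal to `P₁(e)`. -/
def InteriorConditions {Ω : Set Plane} (M : TriMesh Ω)
    (q : Finset Plane → MvPolynomial (Fin 2) ℝ) : Prop :=
  (∀ T ∈ M.triangles, ∀ T' ∈ M.triangles, ∀ a ∈ T, a ∈ T' →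
      polyFun (q T) a = polyFun (q T') a) ∧
  ∀ a b : Plane, M.IsInteriorEdge a b →
    ∀ T ∈ M.triangles, ∀ T' ∈ M.triangles, a ∈ T → b ∈ T → a ∈ T' → b ∈ T' →
      edgeIntegral a b (fun x => polyFun (q T) x - polyFun (q T') x) = 0 ∧
      ∀ p : Plane →ᵃ[ℝ] ℝ, edgeIntegral a b (fun x =>
        p x * (normalDeriv a b (polyFun (q T)) x - normalDeriv a b (polyFun (q T')) x)) = 0

/-- The boundary conditions defining `B_{h0}³` in terms of the polynomial pieces: vanishing at
the boundary vertices, and, on every boundary edge `e`, mean zero and normal derivative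
orthogonal to `P₁(e)`. -/
def BoundaryConditions {Ω : Set Plane} (M : TriMesh Ω)
    (q : Finset Plane → MvPolynomial (Fin 2) ℝ) : Prop :=
  (∀ T ∈ M.triangles, ∀ a ∈ T, a ∈ frontier Ω → polyFun (q T) a = 0) ∧
  ∀ a b : Plane, M.IsBoundaryEdge a b →
    ∀ T ∈ M.triangles, a ∈ T → b ∈ T →
      edgeIntegral a b (polyFun (q T)) = 0 ∧
      ∀ p : Plane →ᵃ[ℝ] ℝ,
        edgeIntegral a b (fun x => p x * normalDeriv a b (polyFun (q T)) x) = 0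

/-- The nonconforming piecewise cubic space `B_{h0}³`: the piecewise cubic functions in `L²(Ω)`
which satisfy the interior conditions (the space `B_h³`) and also the boundary conditions. -/
def Bh30 {Ω : Set Plane} (M : TriMesh Ω) : Set (Plane → ℝ) :=
  {v | ∃ q, HasPieces M 3 v q ∧ InteriorConditions M q ∧ BoundaryConditions M q}

end

/-!
On a triangle `T` let `φ = div w` and `ψ = rot v`; both are quadratic polynomials, and the integrand
is the Jacobian `∂₁φ ∂₂ψ - ∂₂φ ∂₁ψ`. The proof shows that the sum of the integrals of this Jacobian
over the triangles vanishes for any two nonconforming quadratic finite element functions with zero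
boundary conditions (the Fortin–Soulie element).

* The edge conditions on `B_{h0}³` make every first partial derivative of its members such a
  function: across each edge the jump is orthogonal to the affine functions, and so is the trace on
  the boundary edges. For the normal derivative this is assumed; for the tangential derivative it
  follows from the mean value and vertex conditions by integration by parts along the edge
  (`edgeOrthogonal_gradient`).
* Each triangle carries a bubble `3 (λ₀² + λ₁² + λ₂²) - 2`, orthogonal to the affine functions on
  all three edges. The integral over the triangle of the Jacobian of the bubble and any quadratic
  polynomial is zero, by symmetry under exchanging vertices
  (`IsBary.integral_quadJacobian_bubble`). So `φ` and `ψ` may be changed by multiples of the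
  bubbles.
* On every edge the jump of `φ` takes the same value at both endpoints. Hence the linear
  interpolants of `φ` at the vertices of the triangles differ by constants on the intersections of
  triangles. As the closure of `Ω` is convex, a Poincaré lemma
  (`exists_const_add_eq_of_convex_cover`) gives constants `s T` which make them match, and since the
  boundary of `Ω` is connected the matched values can be taken to vanish there
  (`IsNonconformingQuad.exists_shift`).
* Adding `s T` times the bubble to `φ` on `T` therefore gives a continuous piecewise quadratic
  function which vanishes on the boundary; its extension by zero is a compactly supported Lipschitz
  function on the plane (`IsNonconformingQuad.exists_lipschitz`).
* The Jacobian of two compactly supported Lipschitz functions has integral zero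
  (`LipschitzWith.integral_lineDeriv_mul_lineDeriv_comm`).
-/

noncomputable section

/-! ### Functions that are locally determined on convex sets -/

open Filter Topology Set in
/-- A pointwise local Lipschitz bound with a uniform constant integrates to a global one along
segments. For `L = 0` this says that a locally constant function on a convex set is constant. -/
theorem Convex.abs_sub_le_of_eventually {E : Type*} [NormedAddCommGroup E] [NormedSpace ℝ E]
    {s : Set E} (hs : Convex ℝ s) {f : E → ℝ} {L : ℝ}
    (hf : ∀ x ∈ s, ∀ᶠ y in 𝓝[s] x, |f y - f x| ≤ L * ‖y - x‖) {x y : E} (hx : x ∈ s)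
    (hy : y ∈ s) : |f y - f x| ≤ L * ‖y - x‖ := by
  let γ : ℝ → E := fun t => AffineMap.lineMap x y t
  have hγ : Continuous γ := AffineMap.lineMap_continuous
  have hγs : MapsTo γ (Icc 0 1) s := fun t ht => hs.lineMap_mem hx hy ht
  have hγd : ∀ t z, ‖γ z - γ t‖ = |z - t| * ‖y - x‖ := by
    intro t z
    have h : γ z - γ t = (z - t) • (y - x) := by
      simp only [γ, AffineMap.lineMap_apply_module]
      module
    rw [h, norm_smul, Real.norm_eq_abs]
  set g : ℝ → ℝ := fun t => f (γ t) - f x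
  have hloc : ∀ t ∈ Icc (0 : ℝ) 1, ∀ᶠ z in 𝓝[Icc 0 1] t,
      |g z - g t| ≤ L * ‖y - x‖ * |z - t| := by
    intro t ht
    have h := ((hγ.continuousWithinAt (s := Icc 0 1) (x := t)).tendsto_nhdsWithin hγs).eventually
      (hf _ (hγs ht))
    filter_upwards [h] with z hz
    rw [hγd] at hz
    simp only [g, sub_sub_sub_cancel_right]
    linarith
  have hcont : ContinuousOn g (Icc 0 1) := by
    intro t ht
    rw [ContinuousWithinAt, tendsto_iff_dist_tendsto_zero]
    refine squeeze_zero' (Eventually.of_forall fun z => dist_nonneg) (hloc t ht) ?_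
    have : Continuous fun z : ℝ => L * ‖y - x‖ * |z - t| := by fun_prop
    simpa using (this.tendsto t).mono_left (nhdsWithin_le_nhds (s := Icc (0 : ℝ) 1))
  have key : ∀ ε > 0, |g 1| ≤ L * ‖y - x‖ + ε := by
    intro ε hε
    have := image_norm_le_of_liminf_right_slope_norm_lt_deriv_boundary (f := g)
      (f' := fun _ => L * ‖y - x‖) (B := fun t => (L * ‖y - x‖ + ε) * t)
      (B' := fun _ => L * ‖y - x‖ + ε) hcont ?_ ?_ ?_ ?_ ?_ (x := 1) (by simp)
    · simpa using this
    · intro t ht r hr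
      refine Eventually.frequently ?_
      have h1 := hloc t ⟨ht.1, ht.2.le⟩
      have h2 : ∀ᶠ z in 𝓝[>] t, |g z - g t| ≤ L * ‖y - x‖ * |z - t| := by
        have : Ioo t 1 ∈ 𝓝[>] t := Ioo_mem_nhdsGT ht.2
        rw [eventually_nhdsWithin_iff] at h1
        filter_upwards [this, nhdsWithin_le_nhds h1] with z hz hz'
        exact hz' ⟨ht.1.trans hz.1.le, hz.2.le⟩
      filter_upwards [h2, self_mem_nhdsWithin] with z hz hzt
      have hzt : 0 < z - t := sub_pos.2 hzt
      rw [slope_def_field, div_lt_iff₀ hzt]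
      rw [abs_of_pos hzt] at hz
      have := abs_sub_abs_le_abs_sub (g z) (g t)
      simp only [Function.comp, Real.norm_eq_abs]
      nlinarith
    · simp [g, γ]
    · fun_prop
    · intro t _
      simpa using ((hasDerivAt_id t).const_mul (L * ‖y - x‖ + ε)).hasDerivWithinAt
    · intro t _ _
      linarith
  have := le_of_forall_pos_le_add key
  simpa [g, γ] using this

open Filter Topology in
/-- Near a point `p`, only those members of a finite closed family are met which contain `p`. -/
theorem eventually_forall_mem_imp_mem {X ι : Type*} [TopologicalSpace X] [Finite ι]
    {C : ι → Set X} (hC : ∀ i, IsClosed (C i)) (p : X) : ∀ᶠ y in 𝓝 p, ∀ i, y ∈ C i → p ∈ C i := by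
  rw [eventually_all]
  intro i
  by_cases h : p ∈ C i
  · exact Eventually.of_forall fun _ _ => h
  · filter_upwards [(hC i).isOpen_compl.mem_nhds h] with y hy hy'
    exact absurd hy' hy

open Filter Topology Set in
/-- A Poincaré lemma for finite closed covers of a compact convex set `K`: functions `ℓ i` on
convex pieces `C i` which differ by constants on the overlaps become single-valued on `K` after
adding a constant to each of them. Near every point the pieces fit together to a function, unique
up to a constant; its increments are summed along the segments issuing from a base point. -/
theorem exists_const_add_eq_of_convex_cover {E ι : Type*} [NormedAddCommGroup E]
    [NormedSpace ℝ E] [Finite ι] {K : Set E} (hK : Convex ℝ K) (hKc : IsCompact K)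
    {C : ι → Set E} (hCc : ∀ i, IsClosed (C i)) (hCv : ∀ i, Convex ℝ (C i))
    (hcov : K = ⋃ i, C i) {ℓ : ι → E → ℝ}
    (hℓ : ∀ i j x y, x ∈ C i → y ∈ C i → x ∈ C j → y ∈ C j → ℓ i y - ℓ i x = ℓ j y - ℓ j x) :
    ∃ s : ι → ℝ, ∀ i j x, x ∈ C i → x ∈ C j → ℓ i x + s i = ℓ j x + s j := by
  rcases K.eq_empty_or_nonempty with hKe | ⟨o, ho⟩
  · refine ⟨fun _ => 0, fun i j x hx _ => ?_⟩
    have : x ∈ K := hcov ▸ mem_iUnion_of_mem i hx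
    simp [hKe] at this
  have hCK : ∀ i x, x ∈ C i → x ∈ K := fun i x hx => hcov ▸ mem_iUnion_of_mem i hx
  have hstar : ∀ p : E, ∃ r > 0, ∀ y ∈ Metric.ball p r, ∀ i, y ∈ C i → p ∈ C i := fun p =>
    Metric.eventually_nhds_iff_ball.1 (eventually_forall_mem_imp_mem hCc p)
  choose r hr hstar using hstar
  have hidx : ∀ x : E, ∃ i, x ∈ K → x ∈ C i := by
    intro x
    obtain ⟨i, -⟩ := mem_iUnion.1 (hcov ▸ ho)
    by_cases hx : x ∈ K
    · obtain ⟨j, hj⟩ := mem_iUnion.1 (hcov ▸ hx)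
      exact ⟨j, fun _ => hj⟩
    · exact ⟨i, fun h => absurd h hx⟩
  choose idx hidx using hidx
  -- `U p` is the local potential on the ball of radius `r p` about `p`
  let U : E → E → ℝ := fun p y => ℓ (idx y) y - ℓ (idx y) p
  have hU : ∀ p y i, y ∈ Metric.ball p (r p) → y ∈ C i → U p y = ℓ i y - ℓ i p := by
    intro p y i hy hi
    have hyi := hidx y (hCK i y hi)
    exact hℓ _ _ p y (hstar p y hy _ hyi) hyi (hstar p y hy _ hi) hi
  have hloc : ∀ p x, x ∈ K → x ∈ Metric.ball p (r p) → ∀ᶠ y in 𝓝 x, ∀ i, y ∈ C i →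
      U p y - U p x = ℓ i y - ℓ i x := by
    intro p x hx hxp
    filter_upwards [eventually_forall_mem_imp_mem hCc x, Metric.isOpen_ball.mem_nhds hxp]
      with y hy hyp i hi
    rw [hU p y i hyp hi, hU p x i hxp (hy i hi)]
    ring
  -- two local potentials differ by a constant where both are defined, as that set is convex
  have hUU : ∀ p q x y, x ∈ K → y ∈ K → x ∈ Metric.ball p (r p) → y ∈ Metric.ball p (r p) →
      x ∈ Metric.ball q (r q) → y ∈ Metric.ball q (r q) → U p y - U p x = U q y - U q x := by
    intro p q x y hx hy hxp hyp hxq hyq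
    have hconv : Convex ℝ (K ∩ (Metric.ball p (r p) ∩ Metric.ball q (r q))) :=
      hK.inter ((convex_ball _ _).inter (convex_ball _ _))
    have := hconv.abs_sub_le_of_eventually (f := fun z => U p z - U q z) (L := 0) ?_
      ⟨hx, hxp, hxq⟩ ⟨hy, hyp, hyq⟩
    · have := abs_nonpos_iff.1 (this.trans (by simp))
      linarith
    · rintro z ⟨hz, hzp, hzq⟩
      filter_upwards [nhdsWithin_le_nhds (hloc p z hz hzp), nhdsWithin_le_nhds (hloc q z hz hzq),
        self_mem_nhdsWithin] with w h1 h2 hw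
      have hi := hidx w hw.1
      have e1 := h1 _ hi
      have e2 := h2 _ hi
      have : U p w - U q w - (U p z - U q z) = 0 := by linarith
      simp [this]
  obtain ⟨δ, hδ, hleb⟩ := lebesgue_number_lemma_of_metric hKc
    (c := fun p => Metric.ball p (r p)) (fun p => Metric.isOpen_ball)
    (fun x _ => mem_iUnion_of_mem x (Metric.mem_ball_self (hr x)))
  choose! P hP using hleb
  -- `D x y` is the increment from `x` to a point `y` at distance less than `δ`
  let D : E → E → ℝ := fun x y => U (P x) y - U (P x) x
  have hD : ∀ p x y, x ∈ K → y ∈ K → dist y x < δ → x ∈ Metric.ball p (r p) →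
      y ∈ Metric.ball p (r p) → D x y = U p y - U p x := fun p x y hx hy hxy hxp hyp =>
    hUU _ _ x y hx hy (hP x hx (Metric.mem_ball_self hδ)) (hP x hx hxy) hxp hyp
  obtain ⟨R, hR⟩ := hKc.isBounded.subset_closedBall o
  obtain ⟨N, hN⟩ := exists_nat_gt (max 0 (R / (δ / 3)))
  have hN0 : (0 : ℝ) < N := (le_max_left _ _).trans_lt hN
  have hRN : R / N < δ / 3 := by
    have := (le_max_right _ _).trans_lt hN
    rw [div_lt_iff₀ (by positivity)] at this
    rw [div_lt_iff₀ hN0]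
    linarith
  -- `X x` subdivides the segment from the base point `o` to `x` into `N` steps
  let X : E → ℕ → E := fun x k => AffineMap.lineMap o x ((k : ℝ) / N)
  have hXK : ∀ x ∈ K, ∀ k ≤ N, X x k ∈ K := fun x hx k hk =>
    hK.lineMap_mem ho hx ⟨by positivity, by rw [div_le_one hN0]; exact_mod_cast hk⟩
  have hXstep : ∀ x ∈ K, ∀ k, dist (X x (k + 1)) (X x k) < δ / 3 := by
    intro x hx k
    have h : X x (k + 1) - X x k = (1 / N : ℝ) • (x - o) := by
      simp only [X, AffineMap.lineMap_apply_module', Nat.cast_add, Nat.cast_one, add_div]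
      module
    rw [dist_eq_norm, h, norm_smul, Real.norm_of_nonneg (by positivity)]
    have hxo : ‖x - o‖ ≤ R := by simpa [dist_eq_norm] using hR hx
    calc 1 / (N : ℝ) * ‖x - o‖ ≤ 1 / N * R := by gcongr
      _ = R / N := by ring
      _ < δ / 3 := hRN
  have hXY : ∀ x y, ∀ k ≤ N, dist (X y k) (X x k) ≤ dist y x := by
    intro x y k hk
    have h : X y k - X x k = ((k : ℝ) / N) • (y - x) := by
      simp only [X, AffineMap.lineMap_apply_module']
      module
    rw [dist_eq_norm, h, norm_smul, Real.norm_of_nonneg (by positivity), dist_eq_norm]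
    refine mul_le_of_le_one_left (norm_nonneg _) ?_
    rw [div_le_one hN0]
    exact_mod_cast hk
  let u : E → ℝ := fun x => ∑ k ∈ Finset.range N, D (X x k) (X x (k + 1))
  have hu : ∀ x ∈ K, ∀ y ∈ K, dist y x < δ / 3 → u y - u x = D x y := by
    intro x hx y hy hxy
    -- the increments around the quadrilateral `X x k, X x (k + 1), X y (k + 1), X y k` cancel
    have hstep : ∀ k ∈ Finset.range N, D (X y k) (X y (k + 1)) - D (X x k) (X x (k + 1)) =
        D (X x (k + 1)) (X y (k + 1)) - D (X x k) (X y k) := by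
      intro k hk
      have hk' : k + 1 ≤ N := Finset.mem_range.1 hk
      have hk := (Nat.le_succ k).trans hk'
      have m1 := hXK x hx k hk
      have m2 := hXK x hx _ hk'
      have m3 := hXK y hy k hk
      have m4 := hXK y hy _ hk'
      have d1 := hXstep x hx k
      have d2 := hXstep y hy k
      have d3 := hXY x y k hk
      have d4 := hXY x y _ hk'
      have d5 := dist_triangle (X y (k + 1)) (X y k) (X x k)
      have b := hP _ m1
      have b1 := b (Metric.mem_ball_self hδ)
      have b2 := b (show X x (k + 1) ∈ _ from Metric.mem_ball.2 (by linarith))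
      have b3 := b (show X y k ∈ _ from Metric.mem_ball.2 (by linarith))
      have b4 := b (show X y (k + 1) ∈ _ from Metric.mem_ball.2 (by linarith))
      rw [hD _ _ _ m3 m4 (by linarith) b3 b4, hD _ _ _ m1 m2 (by linarith) b1 b2,
        hD _ _ _ m2 m4 (by linarith) b2 b4, hD _ _ _ m1 m3 (by linarith) b1 b3]
      ring
    have h0 : D (X x 0) (X y 0) = 0 := by simp [X, D]
    have h1 : D (X x N) (X y N) = D x y := by simp [X, div_self hN0.ne']
    rw [← Finset.sum_sub_distrib, Finset.sum_congr rfl hstep,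
      Finset.sum_range_sub (fun k => D (X x k) (X y k)), h0, h1, sub_zero]
  have hconst : ∀ i, ∀ x ∈ C i, ∀ y ∈ C i, u y - ℓ i y = u x - ℓ i x := by
    intro i x hx y hy
    have := (hCv i).abs_sub_le_of_eventually (f := fun z => u z - ℓ i z) (L := 0) ?_ hx hy
    · have := abs_nonpos_iff.1 (this.trans (by simp))
      linarith
    · intro z hz
      filter_upwards [nhdsWithin_le_nhds (Metric.ball_mem_nhds z (by positivity : 0 < δ / 3)),
        self_mem_nhdsWithin] with w hw hwi
      have hzK := hCK i z hz
      have hb := hP z hzK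
      have hw : dist w z < δ / 3 := hw
      have e1 := hu z hzK w (hCK i w hwi) hw
      have e2 := hU (P z) w i (hb (Metric.mem_ball.2 (by linarith))) hwi
      have e3 := hU (P z) z i (hb (Metric.mem_ball_self hδ)) hz
      have : u w - ℓ i w - (u z - ℓ i z) = 0 := by
        have : D z w = U (P z) w - U (P z) z := rfl
        linarith
      simp [this]
  have hs : ∀ i, ∃ c : ℝ, ∀ x ∈ C i, ℓ i x + c = u x := by
    intro i
    rcases (C i).eq_empty_or_nonempty with h | ⟨x, hx⟩
    · exact ⟨0, by simp [h]⟩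
    · refine ⟨u x - ℓ i x, fun y hy => ?_⟩
      rw [← hconst i x hx y hy]
      ring
  choose s hs using hs
  exact ⟨s, fun i j x hi hj => by rw [hs i x hi, hs j x hj]⟩

/-! ### The Jacobian of compactly supported Lipschitz functions -/

/-- The directional derivatives of a compactly supported Lipschitz function are integrable. -/
theorem LipschitzWith.integrable_lineDeriv {E : Type*} [NormedAddCommGroup E]
    [NormedSpace ℝ E] [FiniteDimensional ℝ E] [MeasurableSpace E] [BorelSpace E]
    {μ : Measure E} [μ.IsAddHaarMeasure] {f : E → ℝ} {A : NNReal} (hf : LipschitzWith A f)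
    (hfc : HasCompactSupport f) (v : E) : Integrable (fun x => lineDeriv ℝ f x v) μ := by
  refine ((hf.locallyIntegrable_lineDeriv v).integrableOn_isCompact
    hfc.isCompact).integrable_of_forall_notMem_eq_zero fun x hx => ?_
  rw [(notMem_tsupport_iff_eventuallyEq.1 hx).lineDeriv_eq]
  simp [lineDeriv]

open Filter Topology in
/-- For Lipschitz functions `f`, `g` with compact support the Jacobian `∂ᵥf ∂ᵤg - ∂ᵤf ∂ᵥg` has
integral zero. Second derivatives are avoided by replacing `∂ᵤg` with a difference quotient, which
commutes with `∂ᵥ`. -/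
theorem LipschitzWith.integral_lineDeriv_mul_lineDeriv_comm {E : Type*} [NormedAddCommGroup E]
    [NormedSpace ℝ E] [FiniteDimensional ℝ E] [MeasurableSpace E] [BorelSpace E]
    {μ : Measure E} [μ.IsAddHaarMeasure] {f g : E → ℝ} {A B : NNReal} (hf : LipschitzWith A f)
    (hg : LipschitzWith B g) (hfc : HasCompactSupport f) (hgc : HasCompactSupport g) (v u : E) :
    ∫ x, lineDeriv ℝ f x v * lineDeriv ℝ g x u ∂μ =
      ∫ x, lineDeriv ℝ f x u * lineDeriv ℝ g x v ∂μ := by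
  have hfi := hf.integrable_lineDeriv (μ := μ) hfc v
  have hgi := hg.integrable_lineDeriv (μ := μ) hgc (-v)
  obtain ⟨Mf, hMf⟩ := hf.continuous.bounded_above_of_compact_support hfc
  obtain ⟨Mg, hMg⟩ := hg.continuous.bounded_above_of_compact_support hgc
  -- integration by parts in the direction `v`, and a translation by `t • u`, move the difference
  -- quotient from `g` to `f`
  have key : ∀ t : ℝ, ∫ x, t⁻¹ • (g (x + t • u) - g x) * lineDeriv ℝ f x v ∂μ =
      ∫ x, t⁻¹ • (f (x + t • -u) - f x) * lineDeriv ℝ g x (-v) ∂μ := by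
    intro t
    have hft : LipschitzWith A fun x => f (x + t • -u) := by
      simpa only [mul_one] using! hf.comp (isometry_add_right (t • -u)).lipschitz
    have hgt : LipschitzWith B fun x => g (x + t • u) := by
      simpa only [mul_one] using! hg.comp (isometry_add_right (t • u)).lipschitz
    have i1 : Integrable (fun x => g (x + t • u) * lineDeriv ℝ f x v) μ :=
      hfi.bdd_mul hgt.continuous.aestronglyMeasurable (.of_forall fun x => hMg _)
    have i2 : Integrable (fun x => g x * lineDeriv ℝ f x v) μ :=
      hfi.bdd_mul hg.continuous.aestronglyMeasurable (.of_forall hMg)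
    have i3 : Integrable (fun x => f (x + t • -u) * lineDeriv ℝ g x (-v)) μ :=
      hgi.bdd_mul hft.continuous.aestronglyMeasurable (.of_forall fun x => hMf _)
    have i4 : Integrable (fun x => f x * lineDeriv ℝ g x (-v)) μ :=
      hgi.bdd_mul hf.continuous.aestronglyMeasurable (.of_forall hMf)
    have e1 : ∫ x, g (x + t • u) * lineDeriv ℝ f x v ∂μ =
        ∫ x, f (x + t • -u) * lineDeriv ℝ g x (-v) ∂μ := by
      have h := hft.integral_lineDeriv_mul_eq (μ := μ) hg hgc v
      simp only [mul_comm (f _), ← h]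
      rw [← integral_add_right_eq_self (fun x => lineDeriv ℝ _ x v * g x) (t • u)]
      refine integral_congr_ae (.of_forall fun x => ?_)
      have : lineDeriv ℝ (fun y => f (y + t • -u)) (x + t • u) v = lineDeriv ℝ f x v := by
        simp only [lineDeriv]
        congr 1
        ext s
        congr 1
        module
      simp only [this, mul_comm (g _)]
    have e2 : ∫ x, g x * lineDeriv ℝ f x v ∂μ = ∫ x, f x * lineDeriv ℝ g x (-v) ∂μ := by
      simpa only [mul_comm] using hf.integral_lineDeriv_mul_eq (μ := μ) hg hgc v
    simp only [smul_eq_mul, mul_assoc, sub_mul, integral_const_mul]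
    rw [integral_sub i1 i2, integral_sub i3 i4, e1, e2]
  have l1 := hg.integral_inv_smul_sub_mul_tendsto_integral_lineDeriv_mul hfi u
  have l2 := hf.integral_inv_smul_sub_mul_tendsto_integral_lineDeriv_mul hgi (-u)
  simp only [key] at l1
  have := tendsto_nhds_unique l1 l2
  simpa only [lineDeriv_neg, neg_mul_neg, mul_comm (lineDeriv ℝ g _ u)] using this

/-! ### Quadratic polynomials on the plane -/

/-- The symmetric bi-affine form (polarization) of the quadratic polynomial with coefficients `q`
with respect to `1, x₁, x₂, x₁², x₁x₂, x₂²`. -/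
def polarQuad (q : Fin 6 → ℝ) (x y : Plane) : ℝ :=
  q 0 + q 1 * ((x 0 + y 0) / 2) + q 2 * ((x 1 + y 1) / 2) + q 3 * (x 0 * y 0) +
    q 4 * ((x 0 * y 1 + x 1 * y 0) / 2) + q 5 * (x 1 * y 1)

/-- The quadratic polynomial function with coefficients `q`. -/
def quad (q : Fin 6 → ℝ) (x : Plane) : ℝ := polarQuad q x x

/-- The partial derivatives of `quad q`. -/
def quadPartial (i : Fin 2) (q : Fin 6 → ℝ) (x : Plane) : ℝ :=
  ![q 1 + 2 * q 3 * x 0 + q 4 * x 1, q 2 + q 4 * x 0 + 2 * q 5 * x 1] i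

/-- The Jacobian determinant `∂₁q ∂₂r - ∂₂q ∂₁r` of two quadratic polynomials. -/
def quadJacobian (q r : Fin 6 → ℝ) (x : Plane) : ℝ :=
  quadPartial 0 q x * quadPartial 1 r x - quadPartial 1 q x * quadPartial 0 r x

theorem quad_add (q r : Fin 6 → ℝ) (x : Plane) : quad (q + r) x = quad q x + quad r x := by
  simp only [quad, polarQuad, Pi.add_apply]; ring

theorem quad_sub (q r : Fin 6 → ℝ) (x : Plane) : quad (q - r) x = quad q x - quad r x := by
  simp only [quad, polarQuad, Pi.sub_apply]; ring

theorem polarQuad_add (q r : Fin 6 → ℝ) (x y : Plane) :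
    polarQuad (q + r) x y = polarQuad q x y + polarQuad r x y := by
  simp only [polarQuad, Pi.add_apply]; ring

theorem polarQuad_sub (q r : Fin 6 → ℝ) (x y : Plane) :
    polarQuad (q - r) x y = polarQuad q x y - polarQuad r x y := by
  simp only [polarQuad, Pi.sub_apply]; ring

theorem polarQuad_smul (s : ℝ) (q : Fin 6 → ℝ) (x y : Plane) :
    polarQuad (s • q) x y = s * polarQuad q x y := by
  simp only [polarQuad, Pi.smul_apply, smul_eq_mul]; ring

theorem polarQuad_comm (q : Fin 6 → ℝ) (x y : Plane) : polarQuad q x y = polarQuad q y x := by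
  simp only [polarQuad]; ring

theorem polarQuad_combo (q : Fin 6 → ℝ) (x x' y : Plane) {s t : ℝ} (h : s + t = 1) :
    polarQuad q (s • x + t • x') y = s * polarQuad q x y + t * polarQuad q x' y := by
  obtain rfl : t = 1 - s := by linarith
  simp only [polarQuad, PiLp.add_apply, PiLp.smul_apply, smul_eq_mul]; ring

/-- A quadratic polynomial vanishes on the convex hull of `S` if its polarization vanishes on
`S × S`. -/
theorem quad_eq_zero_of_mem_convexHull {q : Fin 6 → ℝ} {S : Set Plane}
    (h : ∀ x ∈ S, ∀ y ∈ S, polarQuad q x y = 0) {x : Plane} (hx : x ∈ convexHull ℝ S) :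
    quad q x = 0 := by
  have hconv : ∀ y, Convex ℝ {x | polarQuad q x y = 0} := by
    intro y x hx x' hx' s t _ _ hst
    have hx : polarQuad q x y = 0 := hx
    have hx' : polarQuad q x' y = 0 := hx'
    show polarQuad q _ y = 0
    rw [polarQuad_combo q x x' y hst, hx, hx', mul_zero, mul_zero, add_zero]
  have h1 : ∀ y ∈ S, ∀ x ∈ convexHull ℝ S, polarQuad q x y = 0 := fun y hy x hx =>
    convexHull_min (fun z hz => h z hz y hy) (hconv y) hx
  exact convexHull_min (fun z hz => (polarQuad_comm q z x).trans (h1 z hz x hx)) (hconv x) hx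

theorem hasFDerivAt_quad (q : Fin 6 → ℝ) (x : Plane) :
    HasFDerivAt (quad q) (quadPartial 0 q x • EuclideanSpace.proj (𝕜 := ℝ) 0 +
      quadPartial 1 q x • EuclideanSpace.proj (𝕜 := ℝ) 1 : Plane →L[ℝ] ℝ) x := by
  have h0 : HasFDerivAt (fun y : Plane => y 0) (EuclideanSpace.proj (𝕜 := ℝ) 0 : Plane →L[ℝ] ℝ) x :=
    (EuclideanSpace.proj (𝕜 := ℝ) 0 : Plane →L[ℝ] ℝ).hasFDerivAt
  have h1 : HasFDerivAt (fun y : Plane => y 1) (EuclideanSpace.proj (𝕜 := ℝ) 1 : Plane →L[ℝ] ℝ) x :=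
    (EuclideanSpace.proj (𝕜 := ℝ) 1 : Plane →L[ℝ] ℝ).hasFDerivAt
  have h := (((((h0.const_mul (q 1)).const_add (q 0)).add (h1.const_mul (q 2))).add
    ((h0.mul h0).const_mul (q 3))).add ((h0.mul h1).const_mul (q 4))).add
    ((h1.mul h1).const_mul (q 5))
  refine (h.congr_fderiv ?_).congr_of_eventuallyEq (.of_forall fun y => ?_)
  · ext v
    simp [quadPartial]
    ring
  · simp [quad, polarQuad]
    left
    ring

theorem continuous_quadPartial (i : Fin 2) (q : Fin 6 → ℝ) : Continuous (quadPartial i q) := by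
  fin_cases i
  · change Continuous fun x : Plane => q 1 + 2 * q 3 * x 0 + q 4 * x 1
    fun_prop
  · change Continuous fun x : Plane => q 2 + q 4 * x 0 + 2 * q 5 * x 1
    fun_prop

theorem continuous_quadJacobian (q r : Fin 6 → ℝ) : Continuous (quadJacobian q r) :=
  ((continuous_quadPartial 0 q).mul (continuous_quadPartial 1 r)).sub
    ((continuous_quadPartial 1 q).mul (continuous_quadPartial 0 r))

theorem brokenPartial_quad (i : Fin 2) (q : Fin 6 → ℝ) (x : Plane) :
    brokenPartial i (quad q) x = quadPartial i q x := by
  rw [brokenPartial, (hasFDerivAt_quad q x).fderiv]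
  fin_cases i <;> simp

theorem exists_quad_eq_monomial (a : ℝ) {m n : ℕ} (h : m + n ≤ 2) :
    ∃ c, ∀ x : Plane, quad c x = a * (x 0 ^ m * x 1 ^ n) := by
  have hm : m ≤ 2 := by omega
  have hn : n ≤ 2 := by omega
  interval_cases m <;> interval_cases n <;> first | omega | skip
  · exact ⟨![a, 0, 0, 0, 0, 0], fun x => by simp [quad, polarQuad]⟩
  · exact ⟨![0, 0, a, 0, 0, 0], fun x => by simp [quad, polarQuad]⟩
  · exact ⟨![0, 0, 0, 0, 0, a], fun x => by simp [quad, polarQuad]; left; ring⟩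
  · exact ⟨![0, a, 0, 0, 0, 0], fun x => by simp [quad, polarQuad]⟩
  · exact ⟨![0, 0, 0, 0, a, 0], fun x => by simp [quad, polarQuad]; left; ring⟩
  · exact ⟨![0, 0, 0, a, 0, 0], fun x => by simp [quad, polarQuad]; left; ring⟩

/-- The gradient of a polynomial of degree at most three consists of quadratic polynomials. -/
theorem exists_hasFDerivAt_polyFun {p : MvPolynomial (Fin 2) ℝ} (hp : p.totalDegree ≤ 3) :
    ∃ c d, ∀ x, HasFDerivAt (polyFun p) (quad c x • EuclideanSpace.proj (𝕜 := ℝ) 0 +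
      quad d x • EuclideanSpace.proj (𝕜 := ℝ) 1 : Plane →L[ℝ] ℝ) x := by
  have hsum : polyFun p = ∑ m ∈ p.support, fun x : Plane =>
      p.coeff m * (x 0 ^ m 0 * x 1 ^ m 1) := by
    ext x
    simp [polyFun, MvPolynomial.eval_eq', Fin.prod_univ_two]
  rw [hsum]
  refine Finset.sum_induction _ (fun f : Plane → ℝ => ∃ c d, ∀ x, HasFDerivAt f
    (quad c x • EuclideanSpace.proj (𝕜 := ℝ) 0 +
      quad d x • EuclideanSpace.proj (𝕜 := ℝ) 1 : Plane →L[ℝ] ℝ) x) ?_ ?_ ?_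
  · rintro f g ⟨c, d, hf⟩ ⟨c', d', hg⟩
    refine ⟨c + c', d + d', fun x => ((hf x).add (hg x)).congr_fderiv ?_⟩
    rw [quad_add, quad_add]
    module
  · refine ⟨0, 0, fun x => (hasFDerivAt_const (0 : ℝ) x).congr_fderiv ?_⟩
    simp [quad, polarQuad]
  · intro m hm
    have hdeg : m 0 + m 1 ≤ 3 := by
      have := (MvPolynomial.le_totalDegree hm).trans hp
      rwa [Finsupp.sum_fintype _ _ (fun _ => rfl), Fin.sum_univ_two] at this
    obtain ⟨c, hc⟩ : ∃ c, ∀ x : Plane, quad c x =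
        p.coeff m * m 0 * (x 0 ^ (m 0 - 1) * x 1 ^ m 1) := by
      rcases Nat.eq_zero_or_pos (m 0) with h | h
      · exact ⟨0, fun x => by simp [h, quad, polarQuad]⟩
      · exact exists_quad_eq_monomial _ (by omega)
    obtain ⟨d, hd⟩ : ∃ d, ∀ x : Plane, quad d x =
        p.coeff m * m 1 * (x 0 ^ m 0 * x 1 ^ (m 1 - 1)) := by
      rcases Nat.eq_zero_or_pos (m 1) with h | h
      · exact ⟨0, fun x => by simp [h, quad, polarQuad]⟩
      · exact exists_quad_eq_monomial _ (by omega)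
    refine ⟨c, d, fun x => ?_⟩
    have h0 : HasFDerivAt (fun y : Plane => y 0)
        (EuclideanSpace.proj (𝕜 := ℝ) 0 : Plane →L[ℝ] ℝ) x :=
      (EuclideanSpace.proj (𝕜 := ℝ) 0 : Plane →L[ℝ] ℝ).hasFDerivAt
    have h1 : HasFDerivAt (fun y : Plane => y 1)
        (EuclideanSpace.proj (𝕜 := ℝ) 1 : Plane →L[ℝ] ℝ) x :=
      (EuclideanSpace.proj (𝕜 := ℝ) 1 : Plane →L[ℝ] ℝ).hasFDerivAt
    refine (((h0.pow (m 0)).mul (h1.pow (m 1))).const_mul (p.coeff m)).congr_fderiv ?_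
    ext v
    simp [hc, hd]
    ring

theorem contDiff_quad (q : Fin 6 → ℝ) : ContDiff ℝ 1 (quad q) := by
  unfold quad polarQuad
  fun_prop

/-! ### Barycentric coordinates and the bubble of a triangle -/

/-- Twice the signed area of the triangle `a b c`. -/
def signedArea (a b c : Plane) : ℝ :=
  (b 0 - a 0) * (c 1 - a 1) - (b 1 - a 1) * (c 0 - a 0)

theorem signedArea_ne_zero {a b c : Plane} (h : AffineIndependent ℝ ![a, b, c]) :
    signedArea a b c ≠ 0 := by
  intro h0
  rw [affineIndependent_iff_not_collinear_set] at h
  apply h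
  by_cases hab : b = a
  · rw [hab, Set.insert_eq_of_mem (Set.mem_insert _ _)]
    exact collinear_pair ℝ a c
  have hne : (b 0 - a 0) ^ 2 + (b 1 - a 1) ^ 2 ≠ 0 := by
    intro hz
    apply hab
    ext i
    fin_cases i
    · show b 0 = a 0
      nlinarith [sq_nonneg (b 0 - a 0), sq_nonneg (b 1 - a 1)]
    · show b 1 = a 1
      nlinarith [sq_nonneg (b 0 - a 0), sq_nonneg (b 1 - a 1)]
  rw [collinear_iff_of_mem (p₀ := a) (by simp)]
  refine ⟨b - a, ?_⟩
  rintro p (rfl | rfl | rfl)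
  · exact ⟨0, by simp⟩
  · exact ⟨1, by simp⟩
  · refine ⟨((b 0 - a 0) * (p 0 - a 0) + (b 1 - a 1) * (p 1 - a 1)) /
      ((b 0 - a 0) ^ 2 + (b 1 - a 1) ^ 2), ?_⟩
    simp only [signedArea] at h0
    ext i
    fin_cases i
    · simp only [vadd_eq_add, Fin.zero_eta, PiLp.add_apply, PiLp.smul_apply, PiLp.sub_apply,
        smul_eq_mul]
      field_simp
      linear_combination -(b 1 - a 1) * h0
    · simp only [vadd_eq_add, Fin.mk_one, PiLp.add_apply, PiLp.smul_apply, PiLp.sub_apply,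
        smul_eq_mul]
      field_simp
      linear_combination (b 0 - a 0) * h0

/-- The affine function with coefficients `l` with respect to `1, x₁, x₂`. -/
def affineFun (l : Fin 3 → ℝ) (x : Plane) : ℝ := l 0 + l 1 * x 0 + l 2 * x 1

/-- `l i`, `i = 0, 1, 2`, are the coefficients of the barycentric coordinates of the triangle with
vertices `V 0, V 1, V 2`. The equations say that the matrices `(l i k)` and `(1, V j)` are inverse
to each other, in both orders. -/
structure IsBary (V : Fin 3 → Plane) (l : Fin 3 → Fin 3 → ℝ) : Prop where
  apply_vertex : ∀ i j, affineFun (l i) (V j) = if i = j then 1 else 0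
  sum_coeff : ∀ k, ∑ i, l i k = if k = 0 then 1 else 0
  sum_coeff_mul : ∀ (k : Fin 3) (m : Fin 2), ∑ i, l i k * V i m = if k = m.succ then 1 else 0

theorem exists_isBary {V : Fin 3 → Plane} (h : signedArea (V 0) (V 1) (V 2) ≠ 0) :
    ∃ l, IsBary V l := by
  refine ⟨fun i k => ![V (i + 1) 0 * V (i + 2) 1 - V (i + 1) 1 * V (i + 2) 0,
    V (i + 1) 1 - V (i + 2) 1, V (i + 2) 0 - V (i + 1) 0] k / signedArea (V 0) (V 1) (V 2),
    ?_, ?_, ?_⟩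
  · intro i j
    fin_cases i <;> fin_cases j <;> simp [affineFun] <;> field_simp <;> simp [signedArea] <;> ring
  · intro k
    fin_cases k <;> simp [Fin.sum_univ_three] <;> field_simp
    · simp [signedArea]
      ring
    all_goals simp
  · intro k m
    fin_cases k <;> fin_cases m <;> simp [Fin.sum_univ_three] <;> field_simp <;>
      simp [signedArea] <;> ring

/-- Expansion of the polarization in barycentric coordinates: `x` is the combination of the vertices
with weights `λᵢ(x)`. -/
theorem IsBary.polarQuad_vertex {V : Fin 3 → Plane} {l : Fin 3 → Fin 3 → ℝ} (h : IsBary V l)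
    (r : Fin 6 → ℝ) (x y : Plane) :
    polarQuad r x y = ∑ i, affineFun (l i) x * polarQuad r (V i) y := by
  have e : ∀ k, ∑ i, l i k * polarQuad r (V i) y =
      (r 0 + r 1 * (y 0 / 2) + r 2 * (y 1 / 2)) * (∑ i, l i k) +
      (r 1 / 2 + r 3 * y 0 + r 4 * (y 1 / 2)) * (∑ i, l i k * V i 0) +
      (r 2 / 2 + r 4 * (y 0 / 2) + r 5 * y 1) * (∑ i, l i k * V i 1) := by
    intro k
    simp only [Fin.sum_univ_three, polarQuad]
    ring
  have e' : ∑ i, affineFun (l i) x * polarQuad r (V i) y = ∑ i, l i 0 * polarQuad r (V i) y +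
      x 0 * ∑ i, l i 1 * polarQuad r (V i) y + x 1 * ∑ i, l i 2 * polarQuad r (V i) y := by
    simp only [Fin.sum_univ_three, affineFun]
    ring
  rw [e', e, e, e]
  simp only [h.sum_coeff, h.sum_coeff_mul]
  simp [polarQuad, Fin.ext_iff]
  ring

/-- The expansion of `IsBary.polarQuad_vertex`, differentiated in the coordinate direction `k`. -/
theorem IsBary.quadPartial_eq {V : Fin 3 → Plane} {l : Fin 3 → Fin 3 → ℝ} (h : IsBary V l)
    (k : Fin 2) (r : Fin 6 → ℝ) (x : Plane) :
    quadPartial k r x = 2 * ∑ j, l j k.succ * polarQuad r (V j) x := by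
  have e : ∑ i, l i k.succ * polarQuad r (V i) x =
      (r 0 + r 1 * (x 0 / 2) + r 2 * (x 1 / 2)) * (∑ i, l i k.succ) +
      (r 1 / 2 + r 3 * x 0 + r 4 * (x 1 / 2)) * (∑ i, l i k.succ * V i 0) +
      (r 2 / 2 + r 4 * (x 0 / 2) + r 5 * x 1) * (∑ i, l i k.succ * V i 1) := by
    simp only [Fin.sum_univ_three, polarQuad]
    ring
  rw [e]
  simp only [h.sum_coeff, h.sum_coeff_mul]
  fin_cases k <;> simp [quadPartial, Fin.ext_iff] <;> ring

/-- The bubble `3 (λ₀² + λ₁² + λ₂²) - 2` of a triangle with barycentric coordinates `λᵢ`. It is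
orthogonal to all affine functions on each of the three edges. -/
def bubble (l : Fin 3 → Fin 3 → ℝ) : Fin 6 → ℝ :=
  ![3 * ∑ i, l i 0 ^ 2 - 2, 6 * ∑ i, l i 0 * l i 1, 6 * ∑ i, l i 0 * l i 2,
    3 * ∑ i, l i 1 ^ 2, 6 * ∑ i, l i 1 * l i 2, 3 * ∑ i, l i 2 ^ 2]

theorem polarQuad_bubble (l : Fin 3 → Fin 3 → ℝ) (x y : Plane) :
    polarQuad (bubble l) x y = 3 * ∑ i, affineFun (l i) x * affineFun (l i) y - 2 := by
  simp [polarQuad, bubble, affineFun, Fin.sum_univ_three]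
  ring

theorem quadPartial_bubble (l : Fin 3 → Fin 3 → ℝ) (k : Fin 2) (x : Plane) :
    quadPartial k (bubble l) x = 6 * ∑ i, affineFun (l i) x * l i k.succ := by
  fin_cases k <;> simp [quadPartial, bubble, affineFun, Fin.sum_univ_three] <;> ring

theorem IsBary.polarQuad_bubble_vertex {V : Fin 3 → Plane} {l : Fin 3 → Fin 3 → ℝ}
    (h : IsBary V l) (i j : Fin 3) :
    polarQuad (bubble l) (V i) (V j) = if i = j then 1 else -2 := by
  rw [polarQuad_bubble]
  simp only [h.apply_vertex]
  fin_cases i <;> fin_cases j <;> simp <;> norm_num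

/-- The Jacobian of the bubble and a quadratic polynomial in barycentric coordinates. The
constant factor is `12` times the common value of the Jacobians of `(λ₀, λ₁)`, `(λ₁, λ₂)` and
`(λ₂, λ₀)`. -/
theorem IsBary.quadJacobian_bubble {V : Fin 3 → Plane} {l : Fin 3 → Fin 3 → ℝ} (h : IsBary V l)
    (r : Fin 6 → ℝ) (x : Plane) :
    quadJacobian (bubble l) r x = 12 * (l 0 1 * l 1 2 - l 0 2 * l 1 1) *
      ∑ j, ∑ i, polarQuad r (V i) (V j) * (affineFun (l i) x * affineFun (l (j + 2)) x -
        affineFun (l i) x * affineFun (l (j + 1)) x) := by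
  have hR : ∀ j, polarQuad r (V j) x =
      ∑ i, affineFun (l i) x * polarQuad r (V i) (V j) := fun j => by
    rw [polarQuad_comm]; exact h.polarQuad_vertex r x (V j)
  have hsum : ∑ j, ∑ i, polarQuad r (V i) (V j) * (affineFun (l i) x * affineFun (l (j + 2)) x -
        affineFun (l i) x * affineFun (l (j + 1)) x) =
      ∑ j, polarQuad r (V j) x * (affineFun (l (j + 2)) x - affineFun (l (j + 1)) x) := by
    refine Finset.sum_congr rfl fun j _ => ?_
    rw [hR j, Finset.sum_mul]
    exact Finset.sum_congr rfl fun i _ => by ring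
  rw [hsum, quadJacobian, quadPartial_bubble, quadPartial_bubble, h.quadPartial_eq,
    h.quadPartial_eq]
  have s1 := h.sum_coeff 1
  have s2 := h.sum_coeff 2
  simp only [Fin.sum_univ_three] at *
  simp at s1 s2 ⊢
  have c1 : l 2 1 = -(l 0 1 + l 1 1) := by linarith
  have c2 : l 2 2 = -(l 0 2 + l 1 2) := by linarith
  rw [c1, c2]
  ring

/-- An affine involution of the plane which permutes the points of `T` preserves integrals over the
triangle with vertices `T`. -/
theorem setIntegral_interior_convexHull_comp_involution {S : Plane →ᵃ[ℝ] Plane}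
    (hS : Function.Involutive S) {T : Set Plane} (hT : S '' T = T) (f : Plane → ℝ) :
    ∫ x in interior (convexHull ℝ T), f (S x) = ∫ x in interior (convexHull ℝ T), f x := by
  have hSc : Continuous S := S.continuous_of_finiteDimensional
  let e : Plane ≃ₜ Plane := ⟨hS.toPerm, hSc, hSc⟩
  -- the linear part is an involution, so its determinant is `1` or `-1`
  have hlin : S.linear ∘ₗ S.linear = LinearMap.id := by
    ext1 x
    have h1 : ∀ y, S.linear y = S y - S 0 := fun y => by
      simpa using S.linearMap_vsub y 0
    simp only [LinearMap.comp_apply, LinearMap.id_apply]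
    rw [h1 x, map_sub, h1, h1, hS x, hS 0]
    simp
  have hdet : |LinearMap.det S.linear| = 1 := by
    have := congrArg LinearMap.det hlin
    rw [LinearMap.det_comp, LinearMap.det_id] at this
    rw [← abs_one, ← sq_eq_sq_iff_abs_eq_abs]
    linarith
  have hdet0 : LinearMap.det S.linear ≠ 0 := fun h => by simp [h] at hdet
  have hL : MeasurePreserving S.linear (volume : Measure Plane) volume := by
    refine ⟨S.linear.continuous_of_finiteDimensional.measurable, ?_⟩
    rw [Measure.map_linearMap_addHaar_eq_smul_addHaar _ hdet0, abs_inv, hdet]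
    simp
  have hmp : MeasurePreserving S (volume : Measure Plane) volume := by
    have := (measurePreserving_add_right (volume : Measure Plane) (S 0)).comp hL
    convert this using 1
    ext1 x
    simpa using congrFun (AffineMap.decomp S) x
  have hpre : S ⁻¹' interior (convexHull ℝ T) = interior (convexHull ℝ T) := by
    have h1 : S ⁻¹' convexHull ℝ T = convexHull ℝ T := by
      conv_rhs => rw [← hT, ← AffineMap.image_convexHull]
      exact (hS.image_eq_preimage_symm ▸ rfl)
    have h2 := e.preimage_interior (convexHull ℝ T)
    have h3 : (e : Plane → Plane) = S := rfl
    rw [h3, h1] at h2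
    exact h2
  have := hmp.setIntegral_preimage_emb e.measurableEmbedding f (interior (convexHull ℝ T))
  rwa [hpre] at this

/-- The affine map which exchanges the vertices `V i` and `V j` of a triangle and fixes the third
one exchanges the corresponding barycentric coordinates. -/
theorem IsBary.exists_swap {V : Fin 3 → Plane} {l : Fin 3 → Fin 3 → ℝ} (h : IsBary V l)
    (i j : Fin 3) : ∃ S : Plane →ᵃ[ℝ] Plane, Function.Involutive S ∧
      S '' Set.range V = Set.range V ∧
      ∀ k x, affineFun (l k) (S x) = affineFun (l (Equiv.swap i j k)) x := by
  let μ : Plane →ₗ[ℝ] ℝ := (l i 1 - l j 1) • (EuclideanSpace.proj (𝕜 := ℝ) 0 : Plane →L[ℝ] ℝ) +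
    (l i 2 - l j 2) • (EuclideanSpace.proj (𝕜 := ℝ) 1 : Plane →L[ℝ] ℝ)
  let S : Plane →ᵃ[ℝ] Plane :=
    { toFun := fun x => x + (affineFun (l i) x - affineFun (l j) x) • (V j - V i)
      linear := LinearMap.id + μ.smulRight (V j - V i)
      map_vadd' := fun x v => by
        simp only [affineFun, μ, vadd_eq_add, PiLp.add_apply, LinearMap.add_apply,
          LinearMap.id_apply, LinearMap.smulRight_apply]
        simp
        module }
  have hSx : ∀ x, S x = x + (affineFun (l i) x - affineFun (l j) x) • (V j - V i) := fun x => rfl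
  have haff : ∀ k x, affineFun (l k) (S x) = affineFun (l (Equiv.swap i j k)) x := by
    intro k x
    have e : affineFun (l k) (S x) = affineFun (l k) x + (affineFun (l i) x - affineFun (l j) x) *
        (affineFun (l k) (V j) - affineFun (l k) (V i)) := by
      rw [hSx]
      simp only [affineFun, PiLp.add_apply, PiLp.smul_apply, PiLp.sub_apply, smul_eq_mul]
      ring
    rw [e, h.apply_vertex, h.apply_vertex, Equiv.swap_apply_def]
    split_ifs <;> simp_all
  have hV : ∀ k, S (V k) = V (Equiv.swap i j k) := by
    intro k
    rw [hSx, h.apply_vertex, h.apply_vertex]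
    by_cases hi : k = i
    · subst hi
      by_cases hj : j = k <;> simp [hj]
    · by_cases hj : k = j
      · subst hj
        simp [Ne.symm hi]
      · simp [Ne.symm hi, Ne.symm hj, Equiv.swap_apply_of_ne_of_ne hi hj]
  have hinv : Function.Involutive S := by
    intro x
    rw [hSx (S x), haff, haff, Equiv.swap_apply_left, Equiv.swap_apply_right, hSx]
    module
  refine ⟨S, hinv, ?_, haff⟩
  rw [← Set.range_comp, show S ∘ V = V ∘ Equiv.swap i j from funext hV]
  exact (Equiv.swap i j).surjective.range_comp V

/-- The bubble is orthogonal to all quadratic polynomials with respect to the Jacobian form: the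
integral of the Jacobian only involves the integrals of `λᵢ λⱼ`, which by symmetry take just two
values, one for `i = j` and one for `i ≠ j`. -/
theorem IsBary.integral_quadJacobian_bubble {V : Fin 3 → Plane} {l : Fin 3 → Fin 3 → ℝ}
    (h : IsBary V l) (r : Fin 6 → ℝ) :
    ∫ x in interior (convexHull ℝ (Set.range V)), quadJacobian (bubble l) r x = 0 := by
  set A := interior (convexHull ℝ (Set.range V))
  have hcompact : IsCompact (convexHull ℝ (Set.range V)) :=
    (Set.finite_range V).isCompact_convexHull ℝ
  have hint : ∀ i j, IntegrableOn (fun x => affineFun (l i) x * affineFun (l j) x) A := by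
    intro i j
    have : Continuous fun x => affineFun (l i) x * affineFun (l j) x := by
      unfold affineFun
      fun_prop
    exact (this.continuousOn.integrableOn_compact hcompact).mono_set interior_subset
  have hsub : ∀ i j, IntegrableOn (fun x => polarQuad r (V i) (V j) * (affineFun (l i) x *
      affineFun (l (j + 2)) x - affineFun (l i) x * affineFun (l (j + 1)) x)) A := fun i j =>
    ((hint i (j + 2)).sub (hint i (j + 1))).const_mul _
  -- the moments of the barycentric coordinates are invariant under exchanging vertices
  let m : Fin 3 → Fin 3 → ℝ := fun i j => ∫ x in A, affineFun (l i) x * affineFun (l j) x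
  have hm : ∀ a b i j, m (Equiv.swap a b i) (Equiv.swap a b j) = m i j := by
    intro a b i j
    obtain ⟨S, hS, hT, hl⟩ := h.exists_swap a b
    have := setIntegral_interior_convexHull_comp_involution hS hT
      (fun x => affineFun (l i) x * affineFun (l j) x)
    simpa only [hl] using this
  have hsymm : ∀ i j, m i j = m j i := fun i j => by simp only [m, mul_comm]
  simp only [h.quadJacobian_bubble]
  rw [integral_const_mul, integral_finsetSum _ fun j _ =>
    integrable_finsetSum _ fun i _ => hsub i j]
  have e : ∀ j, ∫ x in A, ∑ i, polarQuad r (V i) (V j) * (affineFun (l i) x *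
      affineFun (l (j + 2)) x - affineFun (l i) x * affineFun (l (j + 1)) x) =
      ∑ i, polarQuad r (V i) (V j) * (m i (j + 2) - m i (j + 1)) := by
    intro j
    rw [integral_finsetSum _ fun i _ => hsub i j]
    refine Finset.sum_congr rfl fun i _ => ?_
    rw [integral_const_mul, integral_sub (hint i (j + 2)) (hint i (j + 1))]
  rw [Finset.sum_congr rfl fun j _ => e j]
  simp only [Fin.sum_univ_three]
  have m11 : m 1 1 = m 0 0 := by simpa using hm 0 1 0 0
  have m22 : m 2 2 = m 0 0 := by simpa using hm 0 2 0 0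
  have m02 : m 0 2 = m 0 1 := by
    have := hm 1 2 0 1
    rwa [Equiv.swap_apply_left, Equiv.swap_apply_of_ne_of_ne (by decide) (by decide)] at this
  have m12 : m 1 2 = m 0 1 := by
    have := hm 0 1 0 2
    rw [Equiv.swap_apply_left, Equiv.swap_apply_of_ne_of_ne (by decide) (by decide)] at this
    rw [this, m02]
  have a1 : (1 : Fin 3) + 2 = 0 := rfl
  have a2 : (2 : Fin 3) + 2 = 1 := rfl
  have a3 : (2 : Fin 3) + 1 = 0 := rfl
  have a4 : (1 : Fin 3) + 1 = 2 := rfl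
  simp only [zero_add, a1, a2, a3, a4, hsymm 1 0, hsymm 2 0, hsymm 2 1, m11, m22, m02, m12,
    polarQuad_comm r (V 1) (V 0), polarQuad_comm r (V 2) (V 0), polarQuad_comm r (V 2) (V 1)]
  ring

/-- Prescribing the values of an affine function at the vertices of a triangle. -/
theorem IsBary.exists_affineMap {V : Fin 3 → Plane} {l : Fin 3 → Fin 3 → ℝ} (h : IsBary V l)
    (v : Fin 3 → ℝ) : ∃ ℓ : Plane →ᵃ[ℝ] ℝ, ∀ i, ℓ (V i) = v i := by
  let L : Plane →ₗ[ℝ] ℝ := (∑ i, v i * l i 1) • (EuclideanSpace.proj (𝕜 := ℝ) 0 : Plane →L[ℝ] ℝ) +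
    (∑ i, v i * l i 2) • (EuclideanSpace.proj (𝕜 := ℝ) 1 : Plane →L[ℝ] ℝ)
  refine ⟨L.toAffineMap + AffineMap.const ℝ Plane (∑ i, v i * l i 0), fun j => ?_⟩
  have e : (L.toAffineMap + AffineMap.const ℝ Plane (∑ i, v i * l i 0)) (V j) =
      ∑ i, v i * affineFun (l i) (V j) := by
    simp [L, affineFun, Fin.sum_univ_three]
    ring
  rw [e]
  simp [h.apply_vertex]

/-! ### Moments of quadratic polynomials on an edge -/

/-- On the segment from `a` to `b`, the quadratic polynomial `r` is orthogonal to all affine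
functions, i.e. a multiple of the second Legendre polynomial: its values at `a`, at `b` and at the
midpoint are in the proportion `1 : 1 : -1/2`. The value at the midpoint is expressed through the
polarization. -/
def EdgeOrthogonal (r : Fin 6 → ℝ) (a b : Plane) : Prop :=
  quad r a = quad r b ∧ polarQuad r a b = -2 * quad r a

theorem quad_lineMap (r : Fin 6 → ℝ) (a b : Plane) (t : ℝ) :
    quad r (AffineMap.lineMap a b t) =
      (1 - t) ^ 2 * quad r a + 2 * t * (1 - t) * polarQuad r a b + t ^ 2 * quad r b := by
  simp only [AffineMap.lineMap_apply_module, quad, polarQuad, PiLp.add_apply, PiLp.smul_apply,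
    smul_eq_mul]
  ring

theorem edgeOrthogonal_of_moments {r : Fin 6 → ℝ} {a b : Plane}
    (h0 : ∫ t in (0 : ℝ)..1, quad r (AffineMap.lineMap a b t) = 0)
    (h1 : ∫ t in (0 : ℝ)..1, t * quad r (AffineMap.lineMap a b t) = 0) :
    EdgeOrthogonal r a b := by
  set A := quad r a
  set B := quad r b
  set P := polarQuad r a b
  have e0 : ∫ t in (0 : ℝ)..1, quad r (AffineMap.lineMap a b t) = (A + P + B) / 3 := by
    rw [intervalIntegral.integral_eq_sub_of_hasDerivAt
      (f := fun t => A * (t - t ^ 2 + t ^ 3 / 3) + P * (t ^ 2 - 2 * t ^ 3 / 3) + B * (t ^ 3 / 3))]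
    · ring
    · intro t _
      have hp := fun n : ℕ => hasDerivAt_pow (𝕜 := ℝ) n t
      refine (((((hasDerivAt_id t).sub (hp 2)).add ((hp 3).div_const 3)).const_mul A).add
        (((hp 2).sub (((hp 3).const_mul 2).div_const 3)).const_mul P)).add
        (((hp 3).div_const 3).const_mul B) |>.congr_deriv ?_
      rw [quad_lineMap]
      norm_num
      ring
    · simp only [quad_lineMap]
      exact Continuous.intervalIntegrable (by fun_prop) _ _
  have e1 : ∫ t in (0 : ℝ)..1, t * quad r (AffineMap.lineMap a b t) =
      A / 12 + P / 6 + B / 4 := by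
    rw [intervalIntegral.integral_eq_sub_of_hasDerivAt
      (f := fun t => A * (t ^ 2 / 2 - 2 * t ^ 3 / 3 + t ^ 4 / 4) +
        P * (2 * t ^ 3 / 3 - t ^ 4 / 2) + B * (t ^ 4 / 4))]
    · ring
    · intro t _
      have hp := fun n : ℕ => hasDerivAt_pow (𝕜 := ℝ) n t
      refine ((((((hp 2).div_const 2).sub (((hp 3).const_mul 2).div_const 3)).add
        ((hp 4).div_const 4)).const_mul A).add
        (((((hp 3).const_mul 2).div_const 3).sub ((hp 4).div_const 2)).const_mul P)).add
        (((hp 4).div_const 4).const_mul B) |>.congr_deriv ?_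
      rw [quad_lineMap]
      norm_num
      ring
    · simp only [quad_lineMap]
      exact Continuous.intervalIntegrable (by fun_prop) _ _
  rw [e0] at h0
  rw [e1] at h1
  exact ⟨by linarith, by linarith⟩

/-- The edge conditions on a function `f` with quadratic gradient control the moments of order at
most one of the full gradient: those of the normal derivative by assumption, those of the tangential
derivative by integration by parts along the edge. -/
theorem edgeOrthogonal_gradient {f : Plane → ℝ} {c d : Fin 6 → ℝ}
    (hf : ∀ x, HasFDerivAt f (quad c x • EuclideanSpace.proj (𝕜 := ℝ) 0 +
      quad d x • EuclideanSpace.proj (𝕜 := ℝ) 1 : Plane →L[ℝ] ℝ) x)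
    {a b : Plane} (hab : a ≠ b) (ha : f a = 0) (hb : f b = 0) (hm : edgeIntegral a b f = 0)
    (hn : ∀ p : Plane →ᵃ[ℝ] ℝ, edgeIntegral a b (fun x => p x * normalDeriv a b f x) = 0) :
    EdgeOrthogonal c a b ∧ EdgeOrthogonal d a b := by
  set h0 := b 0 - a 0 with hh0
  set h1 := b 1 - a 1 with hh1
  have hd : dist a b ≠ 0 := dist_ne_zero.2 hab
  have hh : h0 ^ 2 + h1 ^ 2 ≠ 0 := by
    intro hz
    apply hab
    ext i
    fin_cases i
    · show a 0 = b 0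
      nlinarith [sq_nonneg h0, sq_nonneg h1]
    · show a 1 = b 1
      nlinarith [sq_nonneg h0, sq_nonneg h1]
  have hcont : ∀ r, Continuous fun t : ℝ => quad r (AffineMap.lineMap a b t) := fun r => by
    simp only [quad_lineMap]
    fun_prop
  -- `h0 • c + h1 • d` is, up to a factor, the tangential derivative
  have htan : EdgeOrthogonal (h0 • c + h1 • d) a b := by
    have hF : ∀ t : ℝ, HasDerivAt (fun t : ℝ => f (AffineMap.lineMap a b t))
        (quad (h0 • c + h1 • d) (AffineMap.lineMap a b t)) t := by
      intro t
      refine ((hf _).comp_hasDerivAt t AffineMap.hasDerivAt_lineMap).congr_deriv ?_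
      simp [quad, polarQuad_add, polarQuad_smul, hh0, hh1]
      ring
    have hFc : Continuous fun t : ℝ => f (AffineMap.lineMap a b t) :=
      continuous_iff_continuousAt.2 fun t => (hF t).continuousAt
    refine edgeOrthogonal_of_moments ?_ ?_
    · rw [intervalIntegral.integral_eq_sub_of_hasDerivAt (fun t _ => hF t)
        ((hcont _).intervalIntegrable _ _)]
      simp [ha, hb]
    · have hm' : ∫ t in (0 : ℝ)..1, f (AffineMap.lineMap a b t) = 0 :=
        (mul_eq_zero.1 hm).resolve_left hd
      have := intervalIntegral.integral_eq_sub_of_hasDerivAt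
        (fun t _ => (hasDerivAt_id t).mul (hF t))
        (((continuous_const.mul hFc).add (continuous_id.mul (hcont _))).intervalIntegrable 0 1)
      have hadd := intervalIntegral.integral_add
        (((continuous_const (y := (1 : ℝ))).mul hFc).intervalIntegrable (μ := volume) 0 1)
        ((continuous_id.mul (hcont (h0 • c + h1 • d))).intervalIntegrable (μ := volume) 0 1)
      have := hadd.symm.trans this
      simpa [hm', ha, hb] using this
  -- `h1 • c - h0 • d` is, up to a factor, the normal derivative
  have hnor : EdgeOrthogonal (h1 • c - h0 • d) a b := by
    have hba : ‖b - a‖⁻¹ ≠ 0 := inv_ne_zero (norm_ne_zero_iff.2 (sub_ne_zero.2 hab.symm))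
    have hN : ∀ x, normalDeriv a b f x = ‖b - a‖⁻¹ * quad (h1 • c - h0 • d) x := by
      intro x
      rw [normalDeriv, (hf x).fderiv]
      simp only [unitNormal, quad, polarQuad_sub, polarQuad_smul, map_smul,
        add_apply, smul_apply, smul_eq_mul]
      simp
      left
      ring
    have key : ∀ p : Plane →ᵃ[ℝ] ℝ, ∫ t in (0 : ℝ)..1, p (AffineMap.lineMap a b t) *
        quad (h1 • c - h0 • d) (AffineMap.lineMap a b t) = 0 := by
      intro p
      have := (mul_eq_zero.1 (hn p)).resolve_left hd
      simp only [hN, mul_left_comm (p _), intervalIntegral.integral_const_mul] at this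
      exact (mul_eq_zero.1 this).resolve_left hba
    refine edgeOrthogonal_of_moments ?_ ?_
    · simpa using key (AffineMap.const ℝ Plane 1)
    · -- the affine function which restricts to the parameter `t` on the edge
      let L : Plane →ₗ[ℝ] ℝ := (h0 / (h0 ^ 2 + h1 ^ 2)) •
        (EuclideanSpace.proj (𝕜 := ℝ) 0 : Plane →L[ℝ] ℝ) + (h1 / (h0 ^ 2 + h1 ^ 2)) •
        (EuclideanSpace.proj (𝕜 := ℝ) 1 : Plane →L[ℝ] ℝ)
      have hL : ∀ t : ℝ, (L.toAffineMap - AffineMap.const ℝ Plane (L a))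
          (AffineMap.lineMap a b t) = t := by
        intro t
        simp [L, AffineMap.lineMap_apply_module]
        field_simp
        ring
      simpa only [hL] using key (L.toAffineMap - AffineMap.const ℝ Plane (L a))
  obtain ⟨t1, t2⟩ := htan
  obtain ⟨n1, n2⟩ := hnor
  simp only [quad, polarQuad_add, polarQuad_sub, polarQuad_smul] at t1 t2 n1 n2
  refine ⟨⟨?_, ?_⟩, ?_, ?_⟩ <;> apply mul_left_cancel₀ hh <;> simp only [quad]
  · linear_combination h0 * t1 + h1 * n1
  · linear_combination h0 * t2 + h1 * n2
  · linear_combination h1 * t1 - h0 * n1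
  · linear_combination h1 * t2 - h0 * n2

theorem EdgeOrthogonal.add {q r : Fin 6 → ℝ} {a b : Plane} (hq : EdgeOrthogonal q a b)
    (hr : EdgeOrthogonal r a b) : EdgeOrthogonal (q + r) a b := by
  refine ⟨?_, ?_⟩
  · rw [quad_add, quad_add, hq.1, hr.1]
  · rw [polarQuad_add, quad_add, hq.2, hr.2]
    ring

theorem EdgeOrthogonal.sub {q r : Fin 6 → ℝ} {a b : Plane} (hq : EdgeOrthogonal q a b)
    (hr : EdgeOrthogonal r a b) : EdgeOrthogonal (q - r) a b := by
  refine ⟨?_, ?_⟩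
  · rw [quad_sub, quad_sub, hq.1, hr.1]
  · rw [polarQuad_sub, quad_sub, hq.2, hr.2]
    ring

/-! ### Geometry of the mesh -/

namespace TriMesh

variable {Ω : Set Plane} {M : TriMesh Ω}

theorem mem_triangles {T : Finset Plane} : T ∈ M.triangles ↔ T ∈ M.faces ∧ T.card = 3 := by
  simp [triangles]

theorem exists_isBary {T : Finset Plane} (hT : T ∈ M.triangles) :
    ∃ V l, IsBary V l ∧ Set.range V = (T : Set Plane) := by
  obtain ⟨hf, hc⟩ := mem_triangles.1 hT
  let e := (Finset.equivFinOfCardEq hc).symm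
  have hind := (M.indep hf).comp_embedding e.toEmbedding
  let V : Fin 3 → Plane := fun i => (e i : Plane)
  have hV : ![V 0, V 1, V 2] = V := by
    ext1 i
    fin_cases i <;> rfl
  obtain ⟨l, hl⟩ := _root_.exists_isBary (V := V)
    (signedArea_ne_zero (by rw [hV]; exact hind))
  refine ⟨V, l, hl, ?_⟩
  show Set.range (Subtype.val ∘ e) = _
  rw [e.surjective.range_comp]
  simp

theorem closure_eq :
    closure Ω = ⋃ T : M.triangles, convexHull ℝ ((T : Finset Plane) : Set Plane) := by
  rw [← M.space_eq]
  ext x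
  rw [Geometry.SimplicialComplex.mem_space_iff, Set.mem_iUnion]
  constructor
  · rintro ⟨s, hs, hx⟩
    obtain ⟨t, ht, hst, hc⟩ := M.pure s hs
    exact ⟨⟨t, mem_triangles.2 ⟨ht, hc⟩⟩, convexHull_mono (by exact_mod_cast hst) hx⟩
  · rintro ⟨⟨T, hT⟩, hx⟩
    exact ⟨T, (mem_triangles.1 hT).1, hx⟩

theorem convexHull_subset_closure {T : Finset Plane} (hT : T ∈ M.triangles) :
    convexHull ℝ (T : Set Plane) ⊆ closure Ω := by
  rw [closure_eq (M := M)]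
  exact Set.subset_iUnion_of_subset ⟨T, hT⟩ subset_rfl

theorem convexHull_inter_subset {T T' : Finset Plane} (hT : T ∈ M.triangles)
    (hT' : T' ∈ M.triangles) : convexHull ℝ (T : Set Plane) ∩ convexHull ℝ (T' : Set Plane) ⊆
      convexHull ℝ (T ∩ T' : Set Plane) :=
  M.inter_subset_convexHull (mem_triangles.1 hT).1 (mem_triangles.1 hT').1

theorem isEdge_of_mem {T : Finset Plane} (hT : T ∈ M.triangles) {a b : Plane} (ha : a ∈ T)
    (hb : b ∈ T) (hab : a ≠ b) : M.IsEdge a b := by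
  classical
  refine ⟨hab, {a, b}, ?_, by simp⟩
  refine M.down_closed (mem_triangles.1 hT).1 ?_ (by simp)
  intro x hx
  rcases Finset.mem_insert.1 hx with rfl | hx
  · exact ha
  · rwa [Finset.mem_singleton.1 hx]

end TriMesh

theorem TriMesh.disjoint_openTri {Ω : Set Plane} {M : TriMesh Ω} {T T' : Finset Plane}
    (hT : T ∈ M.triangles) (hT' : T' ∈ M.triangles) (hne : T ≠ T') :
    Disjoint (openTri T) (openTri T') := by
  classical
  rw [Set.disjoint_iff_inter_eq_empty, openTri, openTri, ← interior_inter]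
  by_contra h
  have hint : (interior (convexHull ℝ (T ∩ T' : Set Plane))).Nonempty :=
    (Set.nonempty_iff_ne_empty.2 h).mono (interior_mono (M.convexHull_inter_subset hT hT'))
  rw [interior_convexHull_nonempty_iff_affineSpan_eq_top] at hint
  have hind : AffineIndependent ℝ ((↑) : ((T ∩ T' : Finset Plane) : Set Plane) → Plane) :=
    (M.indep (M.mem_triangles.1 hT).1).mono (by simp)
  have hcard : (T ∩ T').card = 3 := by
    have := hind.affineSpan_eq_top_iff_card_eq_finrank_add_one.1
      (by rw [Subtype.range_coe, Finset.coe_inter]; exact hint)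
    simpa using this
  have c1 := (M.mem_triangles.1 hT).2
  have c2 := (M.mem_triangles.1 hT').2
  have e1 := Finset.eq_of_subset_of_card_le (Finset.inter_subset_left (s₁ := T) (s₂ := T'))
    (by omega)
  have e2 := Finset.eq_of_subset_of_card_le (Finset.inter_subset_right (s₁ := T) (s₂ := T'))
    (by omega)
  exact hne (e1.symm.trans e2)

/-! ### The boundary of a convex domain -/

/-- A boundary point of a convex open set in a triangle is spanned by vertices which lie, with the
segments joining them, on the boundary: the vertices on a supporting line at the point. -/
theorem exists_mem_convexHull_boundary {Ω : Set Plane} (hopen : IsOpen Ω) (hconv : Convex ℝ Ω)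
    {T : Finset Plane} (hT : convexHull ℝ (T : Set Plane) ⊆ closure Ω) {x : Plane}
    (hx : x ∈ frontier Ω) (hxT : x ∈ convexHull ℝ (T : Set Plane)) :
    ∃ S ⊆ (T : Set Plane), x ∈ convexHull ℝ S ∧
      ∀ a ∈ S, ∀ b ∈ S, segment ℝ a b ⊆ frontier Ω := by
  classical
  have hxΩ : x ∉ Ω := by
    rw [hopen.frontier_eq] at hx
    exact hx.2
  obtain ⟨f, hf⟩ := geometric_hahn_banach_open_point hconv hopen hxΩ
  have hfcl : ∀ y ∈ closure Ω, f y ≤ f x := fun y hy =>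
    closure_minimal (fun z hz => (hf z hz).le) (isClosed_le f.continuous continuous_const) hy
  have hTcl : ∀ a ∈ T, a ∈ closure Ω := fun a ha => hT (subset_convexHull ℝ _ ha)
  refine ⟨(T.filter fun a => f a = f x : Finset Plane),
    by exact_mod_cast Finset.filter_subset _ _, ?_, ?_⟩
  · obtain ⟨w, hw0, hw1, hwx⟩ := Finset.mem_convexHull'.1 hxT
    have hzero : ∀ a ∈ T, w a * (f x - f a) = 0 := by
      refine (Finset.sum_eq_zero_iff_of_nonneg fun a ha =>
        mul_nonneg (hw0 a ha) (sub_nonneg.2 (hfcl a (hTcl a ha)))).1 ?_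
      have : f x = ∑ a ∈ T, w a * f a := by
        conv_lhs => rw [← hwx]
        simp
      simp only [mul_sub, Finset.sum_sub_distrib, ← Finset.sum_mul, hw1, ← this]
      ring
    have hne : ∀ a ∈ T, w a ≠ 0 → f a = f x := fun a ha h0 => by
      have := (mul_eq_zero.1 (hzero a ha)).resolve_left h0
      linarith
    refine Finset.mem_convexHull'.2 ⟨w, fun a ha => hw0 a (Finset.mem_filter.1 ha).1, ?_, ?_⟩
    · rw [Finset.sum_filter_of_ne hne, hw1]
    · rw [Finset.sum_filter_of_ne fun a ha h0 => hne a ha fun h => h0 (by rw [h, zero_smul]), hwx]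
  · intro a ha b hb y hy
    simp only [Finset.coe_filter, Set.mem_ofPred_eq] at ha hb
    rw [hopen.frontier_eq]
    refine ⟨hconv.closure.segment_subset (hTcl a ha.1) (hTcl b hb.1) hy, fun hyΩ => ?_⟩
    obtain ⟨s, t, hs, ht, hst, rfl⟩ := hy
    have := hf _ hyΩ
    simp only [map_add, map_smul, ha.2, hb.2, ← add_smul, hst, one_smul] at this
    exact lt_irrefl _ this

/-- The boundary of a bounded convex open set in the plane is connected. -/
theorem isPreconnected_frontier {Ω : Set Plane} (hne : Ω.Nonempty) (hopen : IsOpen Ω)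
    (hbdd : Bornology.IsBounded Ω) (hconv : Convex ℝ Ω) : IsPreconnected (frontier Ω) := by
  obtain ⟨e, -, -, he⟩ := exists_homeomorph_image_interior_closure_frontier_eq_unitBall hconv
    (by rwa [hopen.interior_eq]) hbdd
  have hrank : 1 < Module.rank ℝ Plane := by
    rw [← Module.finrank_eq_rank, finrank_euclideanSpace_fin]
    norm_num
  have : e.symm '' Metric.sphere 0 1 = frontier Ω := by
    rw [← he, ← Set.image_comp]
    simp
  rw [← this]
  exact (isPreconnected_sphere hrank 0 1).image _ e.symm.continuous.continuousOn

/-! ### Nonconforming quadratic finite element functions -/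

/-- The pieces `φ T`, given by their coefficients, form a nonconforming quadratic finite element
function with zero boundary conditions (the Fortin–Soulie element): the jump across every edge, and
on each boundary edge the trace itself, is orthogonal to the affine functions. -/
structure IsNonconformingQuad {Ω : Set Plane} (M : TriMesh Ω) (φ : Finset Plane → Fin 6 → ℝ) :
    Prop where
  jump : ∀ T ∈ M.triangles, ∀ T' ∈ M.triangles, ∀ a ∈ T, ∀ b ∈ T, a ∈ T' → b ∈ T' → a ≠ b →
    EdgeOrthogonal (φ T - φ T') a b
  boundary : ∀ T ∈ M.triangles, ∀ a ∈ T, ∀ b ∈ T, a ≠ b → segment ℝ a b ⊆ frontier Ω →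
    EdgeOrthogonal (φ T) a b

theorem IsNonconformingQuad.add {Ω : Set Plane} {M : TriMesh Ω} {φ ψ : Finset Plane → Fin 6 → ℝ}
    (hφ : IsNonconformingQuad M φ) (hψ : IsNonconformingQuad M ψ) :
    IsNonconformingQuad M (φ + ψ) := by
  refine ⟨fun T hT T' hT' a ha b hb ha' hb' hab => ?_, fun T hT a ha b hb hab h =>
    (hφ.boundary T hT a ha b hb hab h).add (hψ.boundary T hT a ha b hb hab h)⟩
  rw [Pi.add_apply, Pi.add_apply, add_sub_add_comm]
  exact (hφ.jump T hT T' hT' a ha b hb ha' hb' hab).add (hψ.jump T hT T' hT' a ha b hb ha' hb' hab)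

theorem IsNonconformingQuad.sub {Ω : Set Plane} {M : TriMesh Ω} {φ ψ : Finset Plane → Fin 6 → ℝ}
    (hφ : IsNonconformingQuad M φ) (hψ : IsNonconformingQuad M ψ) :
    IsNonconformingQuad M (φ - ψ) := by
  refine ⟨fun T hT T' hT' a ha b hb ha' hb' hab => ?_, fun T hT a ha b hb hab h =>
    (hφ.boundary T hT a ha b hb hab h).sub (hψ.boundary T hT a ha b hb hab h)⟩
  rw [Pi.sub_apply, Pi.sub_apply, sub_sub_sub_comm]
  exact (hφ.jump T hT T' hT' a ha b hb ha' hb' hab).sub (hψ.jump T hT T' hT' a ha b hb ha' hb' hab)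

/-- The broken partial derivatives of a function in `B_{h0}³` are nonconforming quadratic finite
element functions with zero boundary conditions. -/
theorem exists_isNonconformingQuad_brokenPartial {Ω : Set Plane} {M : TriMesh Ω} {v : Plane → ℝ}
    (hv : v ∈ Bh30 M) : ∃ c : Fin 2 → Finset Plane → Fin 6 → ℝ, ∀ i, IsNonconformingQuad M (c i) ∧
      ∀ T ∈ M.triangles, ∀ x ∈ openTri T, brokenPartial i v x = quad (c i T) x := by
  obtain ⟨q, ⟨-, hq⟩, ⟨hvert, hint⟩, hbvert, hbdry⟩ := hv
  have hgrad : ∀ T, ∃ c d, T ∈ M.triangles → ∀ x, HasFDerivAt (polyFun (q T))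
      (quad c x • EuclideanSpace.proj (𝕜 := ℝ) 0 +
        quad d x • EuclideanSpace.proj (𝕜 := ℝ) 1 : Plane →L[ℝ] ℝ) x := by
    intro T
    by_cases hT : T ∈ M.triangles
    · obtain ⟨c, d, h⟩ := exists_hasFDerivAt_polyFun (hq T hT).1
      exact ⟨c, d, fun _ => h⟩
    · exact ⟨0, 0, fun h => absurd h hT⟩
  choose c d hcd using hgrad
  have hb : ∀ T ∈ M.triangles, ∀ a ∈ T, ∀ b ∈ T, a ≠ b → segment ℝ a b ⊆ frontier Ω →
      EdgeOrthogonal (c T) a b ∧ EdgeOrthogonal (d T) a b := by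
    intro T hT a ha b hb hab hseg
    obtain ⟨h1, h2⟩ := hbdry a b ⟨M.isEdge_of_mem hT ha hb hab, hseg⟩ T hT ha hb
    exact edgeOrthogonal_gradient (hcd T hT) hab
      (hbvert T hT a ha (hseg (left_mem_segment ℝ a b)))
      (hbvert T hT b hb (hseg (right_mem_segment ℝ a b))) h1 h2
  have hj : ∀ T ∈ M.triangles, ∀ T' ∈ M.triangles, ∀ a ∈ T, ∀ b ∈ T, a ∈ T' → b ∈ T' → a ≠ b →
      EdgeOrthogonal (c T - c T') a b ∧ EdgeOrthogonal (d T - d T') a b := by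
    intro T hT T' hT' a ha b hb1 ha' hb' hab
    by_cases hseg : segment ℝ a b ⊆ frontier Ω
    · have e := hb T hT a ha b hb1 hab hseg
      have e' := hb T' hT' a ha' b hb' hab hseg
      exact ⟨e.1.sub e'.1, e.2.sub e'.2⟩
    · obtain ⟨h1, h2⟩ := hint a b ⟨M.isEdge_of_mem hT ha hb1 hab, hseg⟩ T hT T' hT' ha hb1 ha' hb'
      refine edgeOrthogonal_gradient (f := fun x => polyFun (q T) x - polyFun (q T') x)
        (fun x => ((hcd T hT x).fun_sub (hcd T' hT' x)).congr_fderiv ?_) hab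
        (sub_eq_zero.2 (hvert T hT T' hT' a ha ha'))
        (sub_eq_zero.2 (hvert T hT T' hT' b hb1 hb')) h1 fun p => ?_
      · rw [quad_sub, quad_sub]
        module
      · rw [← h2 p]
        congr 1
        ext x
        rw [normalDeriv, ((hcd T hT x).fun_sub (hcd T' hT' x)).fderiv, normalDeriv, normalDeriv,
          (hcd T hT x).fderiv, (hcd T' hT' x).fderiv]
        rfl
  refine ⟨![c, d], fun i => ⟨⟨fun T hT T' hT' a ha b hb1 ha' hb' hab => ?_,
    fun T hT a ha b hb1 hab hseg => ?_⟩, fun T hT x hx => ?_⟩⟩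
  · have := hj T hT T' hT' a ha b hb1 ha' hb' hab
    fin_cases i
    exacts [this.1, this.2]
  · have := hb T hT a ha b hb1 hab hseg
    fin_cases i
    exacts [this.1, this.2]
  · have hev : v =ᶠ[nhds x] polyFun (q T) := by
      filter_upwards [isOpen_interior.mem_nhds hx] with y hy using (hq T hT).2 y hy
    rw [brokenPartial, hev.fderiv_eq, (hcd T hT x).fderiv]
    fin_cases i <;> simp

/-! ### Correction to a continuous function -/

open Set Topology in
/-- There are constants `s T` such that the vertex values of `φ T`, shifted by `s T`, do not depend
on the triangle and vanish on the boundary. The Poincaré lemma is applied to the linear interpolants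
`ℓ T` of `φ T`. The function `u` which they form is constant on the boundary: it is continuous, the
boundary is connected, and the only values of `u` there are those at the finitely many vertices. -/
theorem IsNonconformingQuad.exists_shift {Ω : Set Plane} (hne : Ω.Nonempty) (hopen : IsOpen Ω)
    (hbdd : Bornology.IsBounded Ω) (hconv : Convex ℝ Ω) {M : TriMesh Ω}
    {φ : Finset Plane → Fin 6 → ℝ} (hφ : IsNonconformingQuad M φ) :
    ∃ s : Finset Plane → ℝ,
      (∀ T ∈ M.triangles, ∀ T' ∈ M.triangles, ∀ a ∈ T, a ∈ T' →
        quad (φ T) a + s T = quad (φ T') a + s T') ∧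
      ∀ T ∈ M.triangles, ∀ a ∈ T, a ∈ frontier Ω → quad (φ T) a + s T = 0 := by
  classical
  have hℓ : ∀ T : M.triangles, ∃ ℓ : Plane →ᵃ[ℝ] ℝ, ∀ a ∈ (T : Finset Plane),
      ℓ a = quad (φ T) a := by
    rintro ⟨T, hT⟩
    obtain ⟨V, l, hl, hV⟩ := M.exists_isBary hT
    obtain ⟨ℓ, hℓ⟩ := hl.exists_affineMap fun i => quad (φ T) (V i)
    refine ⟨ℓ, fun a ha => ?_⟩
    obtain ⟨i, rfl⟩ : a ∈ Set.range V := hV ▸ ha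
    exact hℓ i
  choose ℓ hℓ using hℓ
  let C : M.triangles → Set Plane := fun T => convexHull ℝ ((T : Finset Plane) : Set Plane)
  have hC : ∀ T, IsClosed (C T) := fun T => T.1.finite_toSet.isClosed_convexHull ℝ
  have hcov : closure Ω = ⋃ T, C T := M.closure_eq
  -- an affine function which takes a single value on a set is constant on its convex hull
  have hconst : ∀ (g : Plane →ᵃ[ℝ] ℝ) (S : Set Plane), (∀ a ∈ S, ∀ b ∈ S, g a = g b) →
      ∀ x ∈ convexHull ℝ S, ∀ a ∈ S, g x = g a := by
    intro g S hS x hx a ha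
    exact convexHull_min (t := g ⁻¹' {g a}) (fun b hb => hS b hb a ha)
      ((convex_singleton _).affine_preimage g) hx
  obtain ⟨s, hs⟩ := exists_const_add_eq_of_convex_cover hconv.closure hbdd.isCompact_closure hC
    (fun T => convex_convexHull ℝ _) hcov (ℓ := fun T => ℓ T) (by
      intro T T' x y hx hy hx' hy'
      have hx := M.convexHull_inter_subset T.2 T'.2 ⟨hx, hx'⟩
      have hy := M.convexHull_inter_subset T.2 T'.2 ⟨hy, hy'⟩
      obtain ⟨a, ha⟩ := convexHull_nonempty_iff.1 ⟨x, hx⟩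
      have := hconst (ℓ T - ℓ T') (T.1 ∩ T'.1 : Set Plane) (by
        rintro a ⟨ha, ha'⟩ b ⟨hb, hb'⟩
        by_cases hab : a = b
        · rw [hab]
        have := (hφ.jump T T.2 T' T'.2 a ha b hb ha' hb' hab).1
        rw [quad_sub, quad_sub] at this
        simpa [hℓ T a ha, hℓ T b hb, hℓ T' a ha', hℓ T' b hb'] using this)
      have e1 := this x hx a ha
      have e2 := this y hy a ha
      simp only [AffineMap.coe_sub, Pi.sub_apply] at e1 e2
      linarith)
  -- `u` is the common value of the shifted interpolants
  have hidx : ∀ x : Plane, ∃ c : ℝ, ∀ T, x ∈ C T → ℓ T x + s T = c := by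
    intro x
    by_cases h : ∃ T, x ∈ C T
    · obtain ⟨T, hT⟩ := h
      exact ⟨ℓ T x + s T, fun T' hT' => hs _ _ x hT' hT⟩
    · exact ⟨0, fun T hT => absurd ⟨T, hT⟩ h⟩
  choose u hu using hidx
  have hucont : ContinuousOn u (closure Ω) := by
    rw [hcov]
    refine (locallyFinite_of_finite _).continuousOn_iUnion hC fun T => ?_
    have : Continuous fun x => ℓ T x + s T :=
      (ℓ T).continuous_of_finiteDimensional.add continuous_const
    exact this.continuousOn.congr fun x hx => (hu x T hx).symm
  have hfin : (u '' frontier Ω).Finite := by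
    refine ((Set.finite_iUnion fun T : M.triangles => T.1.finite_toSet).image u).subset ?_
    rintro _ ⟨x, hx, rfl⟩
    obtain ⟨T, hT⟩ := mem_iUnion.1 (hcov ▸ frontier_subset_closure hx)
    obtain ⟨S, hST, hxS, hS⟩ := exists_mem_convexHull_boundary hopen hconv
      (M.convexHull_subset_closure T.2) hx hT
    obtain ⟨a, ha⟩ := convexHull_nonempty_iff.1 ⟨x, hxS⟩
    refine ⟨a, mem_iUnion.2 ⟨T, hST ha⟩, ?_⟩
    rw [← hu x T hT, ← hu a T (subset_convexHull ℝ _ (hST ha))]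
    congr 1
    refine (hconst (ℓ T) S (fun a ha b hb => ?_) x hxS a ha).symm
    by_cases hab : a = b
    · rw [hab]
    rw [hℓ T a (hST ha), hℓ T b (hST hb)]
    exact (hφ.boundary T T.2 a (hST ha) b (hST hb) hab (hS a ha b hb)).1
  have hsub : (u '' frontier Ω).Subsingleton :=
    hfin.countable.isTotallyDisconnected _ subset_rfl
      ((isPreconnected_frontier hne hopen hbdd hconv).image u
        (hucont.mono frontier_subset_closure))
  obtain ⟨k, hk⟩ : ∃ k, ∀ x ∈ frontier Ω, u x = k := by
    rcases (frontier Ω).eq_empty_or_nonempty with h | ⟨x, hx⟩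
    · exact ⟨0, by simp [h]⟩
    · exact ⟨u x, fun y hy => hsub (mem_image_of_mem u hy) (mem_image_of_mem u hx)⟩
  refine ⟨fun T => if hT : T ∈ M.triangles then s ⟨T, hT⟩ - k else 0, ?_, ?_⟩
  · intro T hT T' hT' a ha ha'
    have := hs ⟨T, hT⟩ ⟨T', hT'⟩ a (subset_convexHull ℝ _ ha) (subset_convexHull ℝ _ ha')
    rw [hℓ ⟨T, hT⟩ a ha, hℓ ⟨T', hT'⟩ a ha'] at this
    simp only [hT, hT', dif_pos]
    linarith
  · intro T hT a ha hafr
    have := hu a ⟨T, hT⟩ (subset_convexHull ℝ _ ha)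
    rw [hℓ ⟨T, hT⟩ a ha, hk a hafr] at this
    simp only [hT, dif_pos]
    linarith

/-- A choice of the bubble on each triangle of a mesh, with the properties used below. -/
theorem TriMesh.exists_bubble {Ω : Set Plane} (M : TriMesh Ω) : ∃ β : Finset Plane → Fin 6 → ℝ,
    ∀ T ∈ M.triangles, (∀ a ∈ T, quad (β T) a = 1) ∧
      (∀ a ∈ T, ∀ b ∈ T, a ≠ b → polarQuad (β T) a b = -2) ∧
      ∀ r, ∫ x in openTri T, quadJacobian (β T) r x = 0 := by
  have : ∀ T : Finset Plane, ∃ β, T ∈ M.triangles → (∀ a ∈ T, quad β a = 1) ∧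
      (∀ a ∈ T, ∀ b ∈ T, a ≠ b → polarQuad β a b = -2) ∧
      ∀ r, ∫ x in openTri T, quadJacobian β r x = 0 := by
    intro T
    by_cases hT : T ∈ M.triangles
    · obtain ⟨V, l, hl, hV⟩ := M.exists_isBary hT
      have hmem : ∀ a ∈ T, ∃ i, V i = a := fun a ha => by
        rwa [← Set.mem_range, hV]
      refine ⟨bubble l, fun _ => ⟨fun a ha => ?_, fun a ha b hb hab => ?_, fun r => ?_⟩⟩
      · obtain ⟨i, rfl⟩ := hmem a ha
        rw [quad, hl.polarQuad_bubble_vertex, if_pos rfl]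
      · obtain ⟨i, rfl⟩ := hmem a ha
        obtain ⟨j, rfl⟩ := hmem b hb
        rw [hl.polarQuad_bubble_vertex, if_neg fun h => hab (by rw [h])]
      · rw [openTri, ← hV]
        exact hl.integral_quadJacobian_bubble r
    · exact ⟨0, fun h => absurd h hT⟩
  choose β hβ using this
  exact ⟨β, hβ⟩

open Set Topology in
/-- After adding a multiple of the bubble on each triangle, a nonconforming quadratic finite element
function with zero boundary conditions becomes continuous: extended by zero, it is a Lipschitz
function on the plane with compact support. -/
theorem IsNonconformingQuad.exists_lipschitz {Ω : Set Plane} (hne : Ω.Nonempty) (hopen : IsOpen Ω)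
    (hbdd : Bornology.IsBounded Ω) (hconv : Convex ℝ Ω) {M : TriMesh Ω}
    {φ : Finset Plane → Fin 6 → ℝ} (hφ : IsNonconformingQuad M φ) {β : Finset Plane → Fin 6 → ℝ}
    (hβ1 : ∀ T ∈ M.triangles, ∀ a ∈ T, quad (β T) a = 1)
    (hβ2 : ∀ T ∈ M.triangles, ∀ a ∈ T, ∀ b ∈ T, a ≠ b → polarQuad (β T) a b = -2) :
    ∃ (s : Finset Plane → ℝ) (Φ : Plane → ℝ) (L : NNReal), LipschitzWith L Φ ∧
      HasCompactSupport Φ ∧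
      (∀ T ∈ M.triangles, ∀ x ∈ convexHull ℝ (T : Set Plane),
        Φ x = quad (φ T + s T • β T) x) ∧
      ∀ x ∉ closure Ω, Φ x = 0 := by
  classical
  obtain ⟨s, hs, hs0⟩ := hφ.exists_shift hne hopen hbdd hconv
  have hvert : ∀ T ∈ M.triangles, ∀ a ∈ T, quad (φ T + s T • β T) a = quad (φ T) a + s T := by
    intro T hT a ha
    have := hβ1 T hT a ha
    rw [quad] at this
    rw [quad, polarQuad_add, polarQuad_smul, this, mul_one, quad]
  have hedge : ∀ T ∈ M.triangles, ∀ a ∈ T, ∀ b ∈ T, a ≠ b →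
      polarQuad (φ T + s T • β T) a b = polarQuad (φ T) a b - 2 * s T := by
    intro T hT a ha b hb hab
    rw [polarQuad_add, polarQuad_smul, hβ2 T hT a ha b hb hab]
    ring
  -- the pieces agree on the intersection of two triangles
  have hagree : ∀ T ∈ M.triangles, ∀ T' ∈ M.triangles, ∀ x ∈ convexHull ℝ (T : Set Plane),
      x ∈ convexHull ℝ (T' : Set Plane) →
      quad (φ T + s T • β T) x = quad (φ T' + s T' • β T') x := by
    intro T hT T' hT' x hx hx'
    rw [← sub_eq_zero, ← quad_sub]
    refine quad_eq_zero_of_mem_convexHull ?_ (M.convexHull_inter_subset hT hT' ⟨hx, hx'⟩)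
    rintro a ⟨ha, ha'⟩ b ⟨hb, hb'⟩
    have h := hs T hT T' hT' a ha ha'
    by_cases hab : a = b
    · subst hab
      have e : quad (φ T + s T • β T - (φ T' + s T' • β T')) a = 0 := by
        rw [quad_sub, hvert T hT a ha, hvert T' hT' a ha', h, sub_self]
      exact e
    · have hj := (hφ.jump T hT T' hT' a ha b hb ha' hb' hab).2
      rw [polarQuad_sub, quad_sub] at hj
      rw [polarQuad_sub, hedge T hT a ha b hb hab, hedge T' hT' a ha' b hb' hab]
      linarith
  -- the pieces vanish on the boundary
  have hbdry : ∀ T ∈ M.triangles, ∀ x ∈ convexHull ℝ (T : Set Plane), x ∈ frontier Ω →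
      quad (φ T + s T • β T) x = 0 := by
    intro T hT x hx hxfr
    obtain ⟨S, hST, hxS, hS⟩ := exists_mem_convexHull_boundary hopen hconv
      (M.convexHull_subset_closure hT) hxfr hx
    refine quad_eq_zero_of_mem_convexHull ?_ hxS
    intro a ha b hb
    have h0 := hs0 T hT a (hST ha) (hS a ha b hb (left_mem_segment ℝ a b))
    by_cases hab : a = b
    · subst hab
      have e : quad (φ T + s T • β T) a = 0 := by rw [hvert T hT a (hST ha), h0]
      exact e
    · have hj := (hφ.boundary T hT a (hST ha) b (hST hb) hab (hS a ha b hb)).2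
      rw [hedge T hT a (hST ha) b (hST hb) hab]
      linarith
  have hval : ∀ x : Plane, ∃ c : ℝ, (∀ T ∈ M.triangles, x ∈ convexHull ℝ (T : Set Plane) →
      c = quad (φ T + s T • β T) x) ∧ (x ∉ Ω → c = 0) := by
    intro x
    by_cases h : ∃ T ∈ M.triangles, x ∈ convexHull ℝ (T : Set Plane)
    · obtain ⟨T, hT, hx⟩ := h
      refine ⟨quad (φ T + s T • β T) x, fun T' hT' hx' => hagree T hT T' hT' x hx hx',
        fun hxΩ => hbdry T hT x hx ?_⟩
      rw [hopen.frontier_eq]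
      exact ⟨M.convexHull_subset_closure hT hx, hxΩ⟩
    · exact ⟨0, fun T hT hx => absurd ⟨T, hT, hx⟩ h, fun _ => rfl⟩
  choose Φ hΦ hΦ0 using hval
  have hlip : ∀ T : M.triangles, ∃ K : NNReal, LipschitzOnWith K (quad (φ T + s T • β T))
      (convexHull ℝ ((T : Finset Plane) : Set Plane)) := fun T =>
    (contDiff_quad _).locallyLipschitz.locallyLipschitzOn.exists_lipschitzOnWith_of_compact
      (T.1.finite_toSet.isCompact_convexHull ℝ)
  choose K hK using hlip
  let L : NNReal := ∑ T, K T
  -- the plane is the union of the triangles and the complement of `Ω`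
  let C : Option M.triangles → Set Plane :=
    fun o => o.elim Ωᶜ fun T => convexHull ℝ ((T : Finset Plane) : Set Plane)
  have hC : ∀ o, IsClosed (C o) := by
    rintro (_ | T)
    · exact hopen.isClosed_compl
    · exact T.1.finite_toSet.isClosed_convexHull ℝ
  refine ⟨s, Φ, L, LipschitzWith.of_dist_le_mul fun x y => ?_, ?_, fun T hT x hx => hΦ x T hT hx,
    fun x hx => hΦ0 x fun h => hx (subset_closure h)⟩
  · rw [dist_comm, dist_comm x, Real.dist_eq, dist_eq_norm]
    refine convex_univ.abs_sub_le_of_eventually (fun x _ => ?_) (mem_univ x) (mem_univ y)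
    rw [nhdsWithin_univ]
    filter_upwards [eventually_forall_mem_imp_mem hC x] with y hy
    by_cases hyΩ : y ∈ Ω
    · have : y ∈ ⋃ T : M.triangles, convexHull ℝ ((T : Finset Plane) : Set Plane) :=
        M.closure_eq ▸ subset_closure hyΩ
      obtain ⟨T, hT⟩ := mem_iUnion.1 this
      have hxT : x ∈ convexHull ℝ ((T : Finset Plane) : Set Plane) := hy (some T) hT
      rw [hΦ y T T.2 hT, hΦ x T T.2 hxT, ← Real.dist_eq, ← dist_eq_norm]
      refine ((hK T).dist_le_mul y hT x hxT).trans ?_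
      gcongr
      exact Finset.single_le_sum (f := K) (fun _ _ => zero_le) (Finset.mem_univ T)
    · rw [hΦ0 y hyΩ, hΦ0 x (hy none hyΩ)]
      simp
      positivity
  · exact HasCompactSupport.intro hbdd.isCompact_closure
      fun x hx => hΦ0 x fun h => hx (subset_closure h)

/-! ### The Jacobian form on finite element functions -/

theorem quadJacobian_add_smul (q r b : Fin 6 → ℝ) (s t : ℝ) (x : Plane) :
    quadJacobian (q + s • b) (r + t • b) x = quadJacobian q r x +
      (s * quadJacobian b r x - t * quadJacobian b q x) := by
  simp [quadJacobian, quadPartial]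
  ring

theorem integrableOn_quadJacobian (q r : Fin 6 → ℝ) (T : Finset Plane) :
    IntegrableOn (quadJacobian q r) (openTri T) :=
  ((continuous_quadJacobian q r).continuousOn.integrableOn_compact
    (T.finite_toSet.isCompact_convexHull ℝ)).mono_set interior_subset

/-- The Jacobian form vanishes on conforming functions: if the pieces `φ T`, `ψ T` fit together to
compactly supported Lipschitz functions on the plane, their Jacobians have total integral zero. -/
theorem TriMesh.sum_integral_quadJacobian_eq_zero {Ω : Set Plane} (M : TriMesh Ω)
    {φ ψ : Finset Plane → Fin 6 → ℝ} {Φ Ψ : Plane → ℝ} {A B : NNReal} (hΦ : LipschitzWith A Φ)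
    (hΨ : LipschitzWith B Ψ) (hΦc : HasCompactSupport Φ) (hΨc : HasCompactSupport Ψ)
    (hΦT : ∀ T ∈ M.triangles, ∀ x ∈ convexHull ℝ (T : Set Plane), Φ x = quad (φ T) x)
    (hΨT : ∀ T ∈ M.triangles, ∀ x ∈ convexHull ℝ (T : Set Plane), Ψ x = quad (ψ T) x)
    (hΦ0 : ∀ x ∉ closure Ω, Φ x = 0) :
    ∑ T ∈ M.triangles, ∫ x in openTri T, quadJacobian (φ T) (ψ T) x = 0 := by
  let e : Fin 2 → Plane := fun i => EuclideanSpace.single i 1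
  let G : Plane → ℝ := fun x => lineDeriv ℝ Φ x (e 0) * lineDeriv ℝ Ψ x (e 1) -
    lineDeriv ℝ Φ x (e 1) * lineDeriv ℝ Ψ x (e 0)
  -- on an open triangle the directional derivatives are those of the polynomial piece
  have hline : ∀ {F : Plane → ℝ} {q : Finset Plane → Fin 6 → ℝ}, (∀ T ∈ M.triangles,
      ∀ x ∈ convexHull ℝ (T : Set Plane), F x = quad (q T) x) → ∀ T ∈ M.triangles,
      ∀ x ∈ openTri T, ∀ i, lineDeriv ℝ F x (e i) = quadPartial i (q T) x := by
    intro F q hF T hT x hx i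
    have hev : F =ᶠ[nhds x] quad (q T) := by
      filter_upwards [isOpen_interior.mem_nhds hx] with y hy using hF T hT y (interior_subset hy)
    rw [hev.lineDeriv_eq, (hasFDerivAt_quad (q T) x).differentiableAt.lineDeriv_eq_fderiv,
      ← brokenPartial_quad, brokenPartial]
  have hG : ∀ T ∈ M.triangles, Set.EqOn G (quadJacobian (φ T) (ψ T)) (openTri T) := by
    intro T hT x hx
    simp only [G, hline hΦT T hT x hx, hline hΨT T hT x hx]
    rfl
  have hint : ∀ i j, Integrable (fun x => lineDeriv ℝ Φ x (e i) * lineDeriv ℝ Ψ x (e j)) := by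
    intro i j
    exact (hΦ.integrable_lineDeriv hΦc (e i)).mul_bdd
      (aestronglyMeasurable_lineDeriv hΨ.continuous _)
      (.of_forall fun x => norm_lineDeriv_le_of_lipschitz ℝ hΨ)
  have hmeas : ∀ T : Finset Plane, MeasurableSet (openTri T) := fun T =>
    isOpen_interior.measurableSet
  -- off the open triangles, a point lies on the boundary of one of them, which is a null set, or in
  -- the open set outside the closure of `Ω`, where `Φ` vanishes
  have hzero : ∀ᵐ x : Plane, x ∉ ⋃ T ∈ M.triangles, openTri T → G x = 0 := by
    have hfr : ∀ᵐ x : Plane, ∀ T ∈ M.triangles, x ∉ frontier (convexHull ℝ (T : Set Plane)) :=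
      (Finset.eventually_all M.triangles).2 fun T _ =>
        compl_mem_ae_iff.2 ((convex_convexHull ℝ _).addHaar_frontier volume)
    filter_upwards [hfr] with x hx hxT
    have hxcl : x ∉ closure Ω := by
      rw [M.closure_eq]
      intro h
      obtain ⟨⟨T, hT⟩, hxh⟩ := Set.mem_iUnion.1 h
      refine hx T hT ⟨subset_closure hxh, fun hxi => hxT ?_⟩
      exact Set.mem_biUnion hT hxi
    have hev : Φ =ᶠ[nhds x] fun _ => 0 := by
      filter_upwards [isClosed_closure.isOpen_compl.mem_nhds hxcl] with y hy using hΦ0 y hy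
    have hzero : ∀ i, lineDeriv ℝ Φ x (e i) = 0 := fun i => by
      rw [hev.lineDeriv_eq]
      simp [lineDeriv]
    simp [G, hzero]
  calc ∑ T ∈ M.triangles, ∫ x in openTri T, quadJacobian (φ T) (ψ T) x
      = ∑ T ∈ M.triangles, ∫ x in openTri T, G x :=
        Finset.sum_congr rfl fun T hT => (setIntegral_congr_fun (hmeas T) (hG T hT)).symm
    _ = ∫ x in ⋃ T ∈ M.triangles, openTri T, G x :=
        (integral_biUnion_finset _ (fun T _ => hmeas T)
          (fun T hT T' hT' hne => TriMesh.disjoint_openTri hT hT' hne)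
          fun T _ => ((hint 0 1).sub (hint 1 0)).integrableOn).symm
    _ = ∫ x, G x := setIntegral_eq_integral_of_ae_compl_eq_zero hzero
    _ = 0 := by
        rw [integral_sub (hint 0 1) (hint 1 0), sub_eq_zero]
        exact hΦ.integral_lineDeriv_mul_lineDeriv_comm hΨ hΦc hΨc _ _

/-- The Jacobian form vanishes on nonconforming quadratic functions: the bubbles by which they
differ from conforming ones do not contribute. -/
theorem IsNonconformingQuad.sum_integral_quadJacobian_eq_zero {Ω : Set Plane} (hne : Ω.Nonempty)
    (hopen : IsOpen Ω) (hbdd : Bornology.IsBounded Ω) (hconv : Convex ℝ Ω) {M : TriMesh Ω}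
    {φ ψ : Finset Plane → Fin 6 → ℝ} (hφ : IsNonconformingQuad M φ)
    (hψ : IsNonconformingQuad M ψ) :
    ∑ T ∈ M.triangles, ∫ x in openTri T, quadJacobian (φ T) (ψ T) x = 0 := by
  obtain ⟨β, hβ⟩ := M.exists_bubble
  obtain ⟨s, Φ, A, hΦ, hΦc, hΦT, hΦ0⟩ := hφ.exists_lipschitz hne hopen hbdd hconv
    (fun T hT => (hβ T hT).1) (fun T hT => (hβ T hT).2.1)
  obtain ⟨t, Ψ, B, hΨ, hΨc, hΨT, -⟩ := hψ.exists_lipschitz hne hopen hbdd hconv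
    (fun T hT => (hβ T hT).1) (fun T hT => (hβ T hT).2.1)
  rw [← M.sum_integral_quadJacobian_eq_zero hΦ hΨ hΦc hΨc hΦT hΨT hΦ0]
  refine Finset.sum_congr rfl fun T hT => ?_
  have h0 := (hβ T hT).2.2
  have i1 := (integrableOn_quadJacobian (β T) (ψ T) T).const_mul (s T)
  have i2 := (integrableOn_quadJacobian (β T) (φ T) T).const_mul (t T)
  have i12 : IntegrableOn (fun x => s T * quadJacobian (β T) (ψ T) x -
    t T * quadJacobian (β T) (φ T) x) (openTri T) := i1.sub i2
  simp only [quadJacobian_add_smul]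
  rw [integral_add (integrableOn_quadJacobian _ _ T) i12, integral_sub i1 i2,
    integral_const_mul, integral_const_mul, h0, h0]
  ring

end

theorem mainTheorem2 {Ω : Set Plane} (hne : Ω.Nonempty) (hopen : IsOpen Ω)
    (hbdd : Bornology.IsBounded Ω) (hconv : Convex ℝ Ω) (M : TriMesh Ω)
    (w v : Fin 2 → Plane → ℝ) (hw : ∀ l, w l ∈ Bh30 M) (hv : ∀ l, v l ∈ Bh30 M) :
    brokenInner M (brokenGrad (brokenDiv w)) (brokenCurl (brokenRot v)) = 0 := by
  -- `c l i` and `d l i` are the pieces of `∂ᵢ (w l)` and `∂ᵢ (v l)`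
  choose c hc using fun l => exists_isNonconformingQuad_brokenPartial (hw l)
  choose d hd using fun l => exists_isNonconformingQuad_brokenPartial (hv l)
  have hφ : IsNonconformingQuad M (c 0 0 + c 1 1) := (hc 0 0).1.add (hc 1 1).1
  have hψ : IsNonconformingQuad M (d 1 0 - d 0 1) := (hd 1 0).1.sub (hd 0 1).1
  rw [brokenInner, ← hφ.sum_integral_quadJacobian_eq_zero hne hopen hbdd hconv hψ]
  refine Finset.sum_congr rfl fun T hT =>
    setIntegral_congr_fun isOpen_interior.measurableSet fun x hx => ?_
  have hdiv : brokenDiv w =ᶠ[nhds x] quad ((c 0 0 + c 1 1) T) := by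
    filter_upwards [isOpen_interior.mem_nhds hx] with y hy
    rw [brokenDiv, (hc 0 0).2 T hT y hy, (hc 1 1).2 T hT y hy, Pi.add_apply, quad_add]
  have hrot : brokenRot v =ᶠ[nhds x] quad ((d 1 0 - d 0 1) T) := by
    filter_upwards [isOpen_interior.mem_nhds hx] with y hy
    rw [brokenRot, (hd 1 0).2 T hT y hy, (hd 0 1).2 T hT y hy, Pi.sub_apply, quad_sub]
  have hdiv' : ∀ i, brokenPartial i (brokenDiv w) x = quadPartial i ((c 0 0 + c 1 1) T) x := by
    intro i
    rw [← brokenPartial_quad, brokenPartial, hdiv.fderiv_eq, brokenPartial]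
  have hrot' : ∀ i, brokenPartial i (brokenRot v) x = quadPartial i ((d 1 0 - d 0 1) T) x := by
    intro i
    rw [← brokenPartial_quad, brokenPartial, hrot.fderiv_eq, brokenPartial]
  simp only [brokenGrad, brokenCurl, hdiv', hrot', quadJacobian, PiLp.inner_apply,
    Fin.sum_univ_two]
  simp
  ring
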